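/- Let $k$ be a field of characteristic $0$ and $n\in\mathbb Z$. A (finite type) formal moduli problem $X=B\mathfrak g$ over $k$ is given by a finite-dimensional $L_\infty$ algebra $\mathfrak g=\mathbb T_o[-1]X$; equivalently, by the cohomological vector field $Q_{\mathfrak g}\in\Gamma(X,\mathbb T_X[1])$ on the graded vector space $\mathfrak g[1]$, of degree $1$, vanishing at $0$, with $[Q_{\mathfrak g},Q_{\mathfrak g}]=0$. Strict maps of formal moduli problems are degree $0$ linear maps commuting with all brackets. A (strict, constant coefficient) $n$-shifted symplectic structure on $X$ is a graded symmetric isomorphism $\omega:\mathfrak g\to\mathfrak g^*[n-2]$ with $\mathcal L_{Q_{\mathfrak g}}\omega=0$; then $Q_{\mathfrak g}$ is the Hamiltonian vector field of a unique function $S\in\mathcal O(X)=\widehat{\mathrm{Sym}}(\mathfrak g^*[-1])$ of degree $n+1$ without constant term. A map of $n$-shifted symplectic formal moduli problems is a strict map that pulls back one symplectic form to the other. A regular embedded Lagrangian $f:L\to X$, $L=B\mathfrak l$, is a strict map whose underlying linear map $\mathfrak l\to\mathfrak g$ is injective with image a Lagrangian subspace, i.e. equal to its own $\omega$-orthogonal.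 An $(n-1)$-shifted homotopy Poisson structure on $L$ is an element $\bar\Pi\in\prod_{j\ge2}\Gamma(L,\mathrm{Sym}^j(\mathbb T_L[-n]))$ of degree $n+1$ with $[Q_{\mathfrak l}+\bar\Pi,Q_{\mathfrak l}+\bar\Pi]=0$ for the Schouten bracket, i.e. the Poisson bracket of $\mathcal O(T^*[n]L)\cong\Gamma(L,\widehat{\mathrm{Sym}}(\mathbb T_L[-n]))$. The twisted cotangent bundle $T^*_{\bar\Pi}[n]L$ is the graded vector space $\mathfrak l\oplus\mathfrak l^*[n-2]$ with its canonical symplectic pairing and the cohomological vector field $Q_{T^*[n]L}+Q_{\bar\Pi}$, where $Q_{\bar\Pi}$ is the Hamiltonian vector field of $\bar\Pi$ and $Q_{T^*[n]L}$ that of $Q_{\mathfrak l}$, viewed as a function on $T^*[n]L$ linear along the fibres. The zero section $\sigma_0:L\to T^*_{\bar\Pi}[n]L$ is the inclusion of the first summand. Proposition. Let $(X,\omega)$ be an $n$-shifted symplectic formal moduli problem and $f:L\to X$ a regular embedded Lagrangian. Then the image of $\mathfrak l$ in $\mathfrak g$ has a graded complement $\mathfrak l_-$ with $\omega|_{\mathfrak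 l_-}=0$. For every such $\mathfrak l_-$, let $\mathfrak g\cong\mathfrak l\oplus\mathfrak l^*[n-2]$ be the isomorphism of graded vector spaces given by $f$ and $\omega:\mathfrak l_-\cong\mathfrak l^*[n-2]$, and let $\bar\Pi=\{S_j\}_{j\ge2}$ be formed by the components $S_j\in\Gamma(L,\mathrm{Sym}^j(\mathbb T_L[-n]))$, $j\geq 2$, of $S$. Then $\bar\Pi$ is an $(n-1)$-shifted homotopy Poisson structure on $L$, $T^*_{\bar\Pi}[n]L$ is an $n$-shifted symplectic formal moduli problem, $\sigma_0$ is a map of formal moduli problems, and there exists a map $\tilde f:T^*_{\bar\Pi}[n]L\to X$ of $n$-shifted symplectic formal moduli problems such that $\tilde f\circ\sigma_0=f$. -/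

import Mathlib

/-!
Conventions.  A (finite type, pointed) formal moduli problem `X = B𝔤` over a field `k` is modelled by
its `L_∞` algebra `𝔤 = 𝕋_o[-1] X`.  We work on the tangent complex `V = 𝕋_o X = 𝔤[1]`, a finite
dimensional `ℤ`-graded vector space with graded pieces `𝒱 i`.  The brackets
`l_r : 𝔤^{⊗ r} → 𝔤[2 - r]` become graded symmetric maps `Q_r : V^{⊗ r} → V` of degree one, which are
the Taylor coefficients at the origin of the cohomological vector field
`Q ∈ Γ(X, 𝕋_X[1]) = ∏_r Hom(Sym^r V, V)[1]`.  Likewise `𝒪(X) = ∏_r Hom(Sym^r V, k)`.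
-/

noncomputable section

namespace ShiftedPoisson

variable {k : Type*} [Field k]
variable {V : Type*} [AddCommGroup V] [Module k V]
variable {W : Type*} [AddCommGroup W] [Module k W]

/-! ### Formal functions and vector fields -/

/-- A formal power series map `V → W`, given by its Taylor coefficients, one multilinear map
`V^r → W` for every `r` (the power series is `v ↦ ∑ᵣ F_r(v, …, v) / r!`). -/
abbrev FormalMap (k V W : Type*) [Field k] [AddCommGroup V] [Module k V]
    [AddCommGroup W] [Module k W] : Type _ :=
  ∀ r : ℕ, MultilinearMap k (fun _ : Fin r => V) W

/-- The ground field in degree zero. -/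
def scalarGrading (k : Type*) [Field k] : ℤ → Submodule k k :=
  fun i => if i = 0 then ⊤ else ⊥

/-- `F` is homogeneous of cohomological degree `d` and its Taylor coefficients are graded
symmetric: exchanging two neighbouring homogeneous arguments `v_i`, `v_{i+1}` costs the Koszul sign
`(-1)^{|v_i| |v_{i+1}|}`. -/
structure IsGradedFormalMap (𝒱 : ℤ → Submodule k V) (𝒲 : ℤ → Submodule k W) (d : ℤ)
    (F : FormalMap k V W) : Prop where
  degree : ∀ (r : ℕ) (a : Fin r → ℤ) (v : Fin r → V), (∀ i, v i ∈ 𝒱 (a i)) →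
    F r v ∈ 𝒲 (∑ i, a i + d)
  symm : ∀ (r : ℕ) (a : Fin r → ℤ) (v : Fin r → V), (∀ i, v i ∈ 𝒱 (a i)) →
    ∀ i j : Fin r, (i : ℕ) + 1 = j →
      F r (v ∘ Equiv.swap i j) = (a i * a j).negOnePow • F r v

/-- The Koszul sign of the unshuffle that moves the arguments with index in `A`, in their order, in
front of the remaining ones, in their order; `a i` is the degree of the `i`-th argument. -/
def koszulSign {r : ℕ} (a : Fin r → ℤ) (A : Finset (Fin r)) : ℤˣ :=
  ∏ i ∈ A, ∏ j ∈ Aᶜ with j < i, (a i * a j).negOnePow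

/-- The derivative of `F` along the vector field `X` (the Taylor coefficients of
`v ↦ (dF)_v (X(v))`), evaluated on homogeneous arguments `v` of degrees `a`:
`∑_A ± F(X(v_A), v_{Aᶜ})`, the sum running over all unshuffles. -/
def derivAlong (F : FormalMap k V W) (X : FormalMap k V V) {r : ℕ} (a : Fin r → ℤ)
    (v : Fin r → V) : W :=
  ∑ A : Finset (Fin r), koszulSign a A •
    F (Aᶜ.card + 1)
      (Fin.cons (X A.card (v ∘ A.orderEmbOfFin rfl)) (v ∘ Aᶜ.orderEmbOfFin rfl))

/-- The graded vector space `V = 𝔤[1]` with the formal vector field `Q` is a formal moduli problem,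
that is, `Q` is an `L_∞` structure on `𝔤`: it has degree one, vanishes at the origin, and
`½ [Q, Q] = Q ∘ Q = 0`. -/
structure IsFormalModuliProblem (𝒱 : ℤ → Submodule k V) (Q : FormalMap k V V) : Prop where
  grading : DirectSum.IsInternal 𝒱
  graded : IsGradedFormalMap 𝒱 𝒱 1 Q
  pointed : Q 0 = 0
  square_zero : ∀ (r : ℕ) (a : Fin r → ℤ) (v : Fin r → V), (∀ i, v i ∈ 𝒱 (a i)) →
    derivAlong Q Q a v = 0

/-- A strict map of formal moduli problems: a degree zero linear map of the tangent complexes that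
intertwines all brackets. -/
structure IsStrictMap (𝒱 : ℤ → Submodule k V) (Q : FormalMap k V V)
    (𝒲 : ℤ → Submodule k W) (R : FormalMap k W W) (f : V →ₗ[k] W) : Prop where
  degree : ∀ (i : ℤ), ∀ v ∈ 𝒱 i, f v ∈ 𝒲 i
  comm : ∀ (r : ℕ) (v : Fin r → V), f (Q r v) = R r (fun i => f (v i))

/-! ### Shifted symplectic structures and Hamiltonian vector fields -/

/-- A strict, constant coefficient `n`-shifted symplectic structure `ω ∈ Γ(X, ∧² 𝕃_X[n])`: a graded
antisymmetric nondegenerate pairing of degree `n` on `V = 𝔤[1]` (equivalently, a graded symmetric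
isomorphism `𝔤 → 𝔤^*[n - 2]`) with `𝓛_Q ω = 0`.  In the last field `v` are the arguments of the
Taylor coefficients of `𝓛_Q ω`, and `x`, `y` are the tangent vectors on which it is evaluated. -/
structure IsShiftedSymplectic (n : ℤ) (𝒱 : ℤ → Submodule k V) (Q : FormalMap k V V)
    (ω : LinearMap.BilinForm k V) : Prop where
  degree : ∀ (i j : ℤ), ∀ x ∈ 𝒱 i, ∀ y ∈ 𝒱 j, i + j ≠ -n → ω x y = 0
  antisymm : ∀ (i j : ℤ), ∀ x ∈ 𝒱 i, ∀ y ∈ 𝒱 j, ω x y = -((i * j).negOnePow • ω y x)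
  nondegenerate : ω.Nondegenerate
  lie_derivative : ∀ (r : ℕ) (a : Fin r → ℤ) (v : Fin r → V), (∀ l, v l ∈ 𝒱 (a l)) →
    ∀ (i j : ℤ), ∀ x ∈ 𝒱 i, ∀ y ∈ 𝒱 j,
      ω (Q (r + 1) (Fin.snoc v x)) y
        + (i * (∑ l, a l + 1)).negOnePow • ω x (Q (r + 1) (Fin.snoc v y)) = 0

/-- The Hamiltonian vector field `X_F = Π_ω (dF)`, determined by
`ω(X_F(v₁, …, v_r), w) = F(v₁, …, v_r, w)`. -/
def hamiltonianVF [FiniteDimensional k V] (ω : LinearMap.BilinForm k V) (hω : ω.Nondegenerate)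
    (F : FormalMap k V k) : FormalMap k V V :=
  fun r => (ω.toDual hω).symm.toLinearMap.compMultilinearMap (F (r + 1)).curryRight

/-- The action functional `S ∈ 𝒪(X)[n + 1]`, the Hamiltonian function without constant term of the
symplectic vector field `Q`: `S(v₁, …, v_r, w) = ω(Q(v₁, …, v_r), w)`. -/
def actionFunctional (ω : LinearMap.BilinForm k V) (Q : FormalMap k V V) : FormalMap k V k
  | 0 => 0
  | r + 1 => MultilinearMap.uncurryRight (ω.compMultilinearMap (Q r))

/-- The Poisson bracket `{F, G} = X_F(G)` on homogeneous arguments `v` of degrees `a`. -/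
def poissonBracket [FiniteDimensional k V] (ω : LinearMap.BilinForm k V) (hω : ω.Nondegenerate)
    (F G : FormalMap k V k) {r : ℕ} (a : Fin r → ℤ) (v : Fin r → V) : k :=
  derivAlong G (hamiltonianVF ω hω F) a v

/-! ### The shifted cotangent bundle and polyvector fields -/

section Cotangent

variable (n : ℤ) (𝒱 : ℤ → Submodule k V)

/-- The grading of `𝕋_o(T^*[n]L) = V ⊕ V^*[n]`: a functional on `V` lies in degree `i` if it is
supported on the piece of degree `-n - i`. -/
def cotangentGrading (i : ℤ) : Submodule k (V × Module.Dual k V) :=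
  (𝒱 i).prod (⨅ j : {j : ℤ // j ≠ -n - i}, (𝒱 j.1).dualAnnihilator)

variable [DirectSum.Decomposition 𝒱]

/-- The operator `v ↦ (-1)^{m |v|} v`. -/
def signTwist (m : ℤ) : V →ₗ[k] V :=
  DirectSum.toModule k ℤ V (fun i => (m * i).negOnePow • (𝒱 i).subtype) ∘ₗ
    (DirectSum.decomposeLinearEquiv 𝒱).toLinearMap

/-- The projection onto the part of parity `e`. -/
def parityProj (e : Fin 2) : V →ₗ[k] V :=
  DirectSum.toModule k ℤ V (fun i => if i % 2 = ((e : ℕ) : ℤ) then (𝒱 i).subtype else 0) ∘ₗ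
    (DirectSum.decomposeLinearEquiv 𝒱).toLinearMap

/-- The canonical `n`-shifted symplectic pairing on `V ⊕ V^*[n]`: it is graded antisymmetric and
`ω((a, 0), (0, η)) = η(a)`. -/
def cotangentForm : LinearMap.BilinForm k (V × Module.Dual k V) :=
  LinearMap.mk₂ k (fun x y => y.2 x.1 - x.2 (signTwist 𝒱 (n + 1) y.1))
    (by intros; simp; ring) (by intros; simp; ring) (by intros; simp; ring) (by intros; simp; ring)

theorem signTwist_of_mem (m : ℤ) {i : ℤ} {v : V} (hv : v ∈ 𝒱 i) :
    signTwist 𝒱 m v = (m * i).negOnePow • v := by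
  simp only [signTwist, LinearMap.comp_apply, LinearEquiv.coe_coe,
    DirectSum.decomposeLinearEquiv_apply, DirectSum.decompose_of_mem 𝒱 hv]
  rw [← DirectSum.lof_eq_of k, DirectSum.toModule_lof]
  rfl

theorem signTwist_signTwist (m : ℤ) (v : V) : signTwist 𝒱 m (signTwist 𝒱 m v) = v := by
  induction v using DirectSum.Decomposition.inductionOn 𝒱 with
  | zero => simp
  | @homogeneous i v =>
    rw [signTwist_of_mem 𝒱 m v.2, signTwist_of_mem 𝒱 m ((𝒱 i).smul_of_tower_mem _ v.2), smul_smul]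
    simp
  | add v w hv hw => rw [map_add, map_add, hv, hw]

theorem cotangentForm_nondegenerate : (cotangentForm n 𝒱).Nondegenerate := by
  constructor
  · rintro ⟨a, ξ⟩ h
    have ha : a = 0 := by
      refine (Module.forall_dual_apply_eq_zero_iff k a).1 fun η => ?_
      simpa [cotangentForm] using h (0, η)
    have hξ : ξ = 0 := by
      ext b
      simpa [cotangentForm, signTwist_signTwist] using h (signTwist 𝒱 (n + 1) b, 0)
    rw [ha, hξ, Prod.mk_zero_zero]
  · rintro ⟨b, η⟩ h
    have hb : signTwist 𝒱 (n + 1) b = 0 := by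
      refine (Module.forall_dual_apply_eq_zero_iff k _).1 fun ξ => ?_
      simpa [cotangentForm] using h (0, ξ)
    have hη : η = 0 := by
      ext a
      simpa [cotangentForm] using h (a, 0)
    rw [← signTwist_signTwist 𝒱 (n + 1) b, hb, map_zero, hη, Prod.mk_zero_zero]

/-- A vector field `Q ∈ Γ(L, 𝕋_L[1])`, seen as a function of degree `n + 1` on `T^*[n]L` that is
linear along the fibres: `(a₁, …, a_r, ξ) ↦ ξ(Q(a₁, …, a_r))`, extended by graded symmetry.  In the
sum, `i` is the position of the covector `ξ` and `e` lists the parities of the other arguments; `ξ`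
is moved to the end past the arguments to the right of it, where only the part of `ξ` of degree
`-n - |Q(a₁, …, a_r)| = -n - 1 - ∑ |a_j|` contributes. -/
def linearHamiltonian (Q : FormalMap k V V) : FormalMap k (V × Module.Dual k V) k
  | 0 => 0
  | r + 1 => ∑ i : Fin (r + 1), ∑ e : Fin r → Fin 2,
      ((n + 1 + ∑ j, ((e j : ℕ) : ℤ)) *
          ∑ j with i ≤ Fin.castSucc j, ((e j : ℕ) : ℤ)).negOnePow •
        LinearMap.uncurryMid (M := fun _ => V × Module.Dual k V) i
          { toFun := fun x => x.2.compMultilinearMap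
              ((Q r).compLinearMap fun j => parityProj 𝒱 (e j) ∘ₗ LinearMap.fst k V _)
            map_add' := fun _ _ => rfl
            map_smul' := fun _ _ => rfl }

/-- The part of weight `j` of a function on `T^*[n]L`, that is, its component in
`Γ(L, Sym^j(𝕋_L[-n]))` under `𝒪(T^*[n]L) ≅ ∏_j Γ(L, Sym^j(𝕋_L[-n]))`. -/
def weightPart (j : ℕ) (F : FormalMap k (V × Module.Dual k V) k) :
    FormalMap k (V × Module.Dual k V) k :=
  fun r => ∑ B ∈ (Finset.univ : Finset (Fin r)).powersetCard j,
    (F r).compLinearMap fun i =>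
      if i ∈ B then LinearMap.inr k V (Module.Dual k V) ∘ₗ LinearMap.snd k V (Module.Dual k V)
      else LinearMap.inl k V (Module.Dual k V) ∘ₗ LinearMap.fst k V (Module.Dual k V)

/-- The sum of the components of weight at least two. -/
def weightGeTwo (F : FormalMap k (V × Module.Dual k V) k) : FormalMap k (V × Module.Dual k V) k :=
  fun r => ∑ j ∈ Finset.Icc 2 r, weightPart j F r

variable [FiniteDimensional k V]

/-- `P = {P_j}_{j ≥ 2} ∈ ∏_{j ≥ 2} Γ(L, Sym^j(𝕋_L[-n]))[n + 1]` is an `(n - 1)`-shifted homotopy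
Poisson structure on the formal moduli problem `L = (V, Q)`: `[Q + P, Q + P] = 0` for the Schouten
bracket of `(n - 1)`-shifted polyvector fields, which is the Poisson bracket of `T^*[n]L`. -/
structure IsHomotopyPoisson (Q : FormalMap k V V) (P : FormalMap k (V × Module.Dual k V) k) :
    Prop where
  graded : IsGradedFormalMap (cotangentGrading n 𝒱) (scalarGrading k) (n + 1) P
  weight_zero : weightPart 0 P = 0
  weight_one : weightPart 1 P = 0
  master : ∀ (r : ℕ) (a : Fin r → ℤ) (u : Fin r → V × Module.Dual k V),
    (∀ i, u i ∈ cotangentGrading n 𝒱 (a i)) →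
      poissonBracket (cotangentForm n 𝒱) (cotangentForm_nondegenerate n 𝒱)
        (linearHamiltonian n 𝒱 Q + P) (linearHamiltonian n 𝒱 Q + P) a u = 0

/-- The cohomological vector field of `T^*[n]L`, with `L_∞` algebra `𝔩 ⋉ 𝔩^*[n - 2]`. -/
def cotangentVF (Q : FormalMap k V V) :
    FormalMap k (V × Module.Dual k V) (V × Module.Dual k V) :=
  hamiltonianVF (cotangentForm n 𝒱) (cotangentForm_nondegenerate n 𝒱) (linearHamiltonian n 𝒱 Q)

/-- The vector field `Q_{T^*[n]L} + Q_P` of the twisted cotangent bundle `T^*_P[n]L`. -/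
def twistedCotangentVF (Q : FormalMap k V V) (P : FormalMap k (V × Module.Dual k V) k) :
    FormalMap k (V × Module.Dual k V) (V × Module.Dual k V) :=
  cotangentVF n 𝒱 Q +
    hamiltonianVF (cotangentForm n 𝒱) (cotangentForm_nondegenerate n 𝒱) P

/-- The zero section `L → T^*_P[n]L`. -/
def zeroSection (k V : Type*) [Field k] [AddCommGroup V] [Module k V] :
    V →ₗ[k] V × Module.Dual k V :=
  LinearMap.inl k V (Module.Dual k V)

end Cotangent

/-! ### Regular embedded Lagrangians and the induced Poisson structure -/

section Lagrangian

variable {T : Type*} [AddCommGroup T] [Module k T]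

/-- A strict map with underlying linear map `f : V → T` is a regular embedded Lagrangian: `f` is
injective and its image is a Lagrangian subspace, equal to its own `ω`-orthogonal. -/
structure IsRegularEmbeddedLagrangian (ω : LinearMap.BilinForm k T) (f : V →ₗ[k] T) : Prop where
  injective : Function.Injective f
  isotropic : ∀ a b : V, ω (f a) (f b) = 0
  coisotropic : ∀ x : T, (∀ a : V, ω (f a) x = 0) → x ∈ LinearMap.range f

/-- A graded isotropic complement `𝔩₋` to the image `𝔩₊` of `f`. -/
structure IsIsotropicComplement (𝒯 : ℤ → Submodule k T) [DirectSum.Decomposition 𝒯]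
    (ω : LinearMap.BilinForm k T) (f : V →ₗ[k] T) (C : Submodule k T) : Prop where
  homogeneous : DirectSum.SetLike.IsHomogeneous 𝒯 C
  isCompl : IsCompl (LinearMap.range f) C
  isotropic : ∀ x ∈ C, ∀ y ∈ C, ω x y = 0

/-- The map `𝔩₋ → 𝔩₊^*` induced by `ω`, namely `w ↦ (a ↦ ω(f a, w))`. -/
def complementToDual (ω : LinearMap.BilinForm k T) (f : V →ₗ[k] T) (C : Submodule k T) :
    C →ₗ[k] Module.Dual k V :=
  LinearMap.compl₂ (ω ∘ₗ f) C.subtype |>.flip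

theorem complementToDual_bijective [FiniteDimensional k T] {ω : LinearMap.BilinForm k T}
    (hω : ω.Nondegenerate) {f : V →ₗ[k] T} (hf : IsRegularEmbeddedLagrangian ω f)
    {C : Submodule k T} (hC : IsCompl (LinearMap.range f) C) :
    Function.Bijective (complementToDual ω f C) := by
  constructor
  · rw [injective_iff_map_eq_zero]
    intro w hw
    have h : (w : T) ∈ LinearMap.range f :=
      hf.coisotropic w fun a => LinearMap.congr_fun hw a
    exact Subtype.ext (Submodule.disjoint_def.1 hC.disjoint _ h w.2)
  · intro ξ
    obtain ⟨g, hg⟩ := f.exists_leftInverse_of_injective (LinearMap.ker_eq_bot.2 hf.injective)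
    obtain ⟨x, hx⟩ := (ω.flip.toDual hω.flip).surjective (ξ ∘ₗ g)
    have hx' : ∀ a, ω (f a) x = ξ a := fun a => by
      have h1 := LinearMap.congr_fun hx (f a)
      rw [LinearMap.BilinForm.toDual_def] at h1
      have h2 : g (f a) = a := LinearMap.congr_fun hg a
      simpa [h2] using h1
    obtain ⟨y, ⟨b, rfl⟩, w, hw, rfl⟩ := Submodule.mem_sup.1
      (hC.sup_eq_top ▸ Submodule.mem_top : x ∈ LinearMap.range f ⊔ C)
    refine ⟨⟨w, hw⟩, LinearMap.ext fun a => ?_⟩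
    have h := hx' a
    rw [map_add, hf.isotropic, zero_add] at h
    exact h

/-- The linear map `𝕋_o(T^*[n]L) = 𝔩₊[1] ⊕ (𝔩₊[1])^*[n] → 𝔩₊[1] ⊕ 𝔩₋[1] = 𝕋_o X` given by `f` and
the inverse of the isomorphism `𝔩₋ ≅ 𝔩₊^*[n - 2]`. -/
def splitting [FiniteDimensional k T] {ω : LinearMap.BilinForm k T}
    (hω : ω.Nondegenerate) {f : V →ₗ[k] T} (hf : IsRegularEmbeddedLagrangian ω f)
    {C : Submodule k T} (hC : IsCompl (LinearMap.range f) C) :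
    V × Module.Dual k V →ₗ[k] T :=
  f.coprod (C.subtype ∘ₗ
    (LinearEquiv.ofBijective (complementToDual ω f C)
      (complementToDual_bijective hω hf hC)).symm.toLinearMap)

/-- The polyvector field `{S_j}_{j ≥ 2}` on the Lagrangian: the components of weight at least two of
the action functional `S` of `X = (T, Q, ω)`, transported to `V ⊕ V^*[n]` along the splitting. -/
def inducedPoisson [FiniteDimensional k T] {ω : LinearMap.BilinForm k T} (Q : FormalMap k T T)
    (hω : ω.Nondegenerate) {f : V →ₗ[k] T} (hf : IsRegularEmbeddedLagrangian ω f)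
    {C : Submodule k T} (hC : IsCompl (LinearMap.range f) C) :
    FormalMap k (V × Module.Dual k V) k :=
  weightGeTwo fun r => (actionFunctional ω Q r).compLinearMap fun _ => splitting hω hf hC

/-- The vector field of the twisted cotangent bundle of the Lagrangian `L = (V, R)` for the induced
Poisson structure. -/
def inducedTwistedVF [FiniteDimensional k T] [FiniteDimensional k V] (n : ℤ)
    (𝒱 : ℤ → Submodule k V) [DirectSum.Decomposition 𝒱] (R : FormalMap k V V)
    {ω : LinearMap.BilinForm k T} (Q : FormalMap k T T)
    (hω : ω.Nondegenerate) {f : V →ₗ[k] T} (hf : IsRegularEmbeddedLagrangian ω f)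
    {C : Submodule k T} (hC : IsCompl (LinearMap.range f) C) :
    FormalMap k (V × Module.Dual k V) (V × Module.Dual k V) :=
  twistedCotangentVF n 𝒱 R (inducedPoisson Q hω hf hC)

end Lagrangian

end ShiftedPoisson

end

open ShiftedPoisson

/-!
The Taylor coefficients of the action functional `S(v₁, …, v_r, w) = ω(Q(v₁, …, v_r), w)` record
`Q` without loss, `Q` is the Hamiltonian vector field of `S`, and `𝓛_Q ω = 0` turns `Q ∘ Q = 0` into
the classical master equation `{S, S} = 0`.

If `p` is the projection onto any graded complement of the Lagrangian `im f` and `θ` is defined by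
`ω(θ x, y) = ω(p x, p y)`, then `θ` takes values in `im f` and `p - ½ θ` is again a projection with
kernel `im f`, now with isotropic image.

An isotropic complement identifies `X` with `V ⊕ V^*[n]` as a graded symplectic vector space, by the
splitting `Φ`.  In the expansion of `Φ^* S` by weight, the part of weight zero is
`ω(Q(f a₁, …), f b) = ω(f(R(a₁, …)), f b) = 0`, and the part of weight one is
`ω(f(R(a₁, …)), Φ(0, ξ)) = ξ(R(a₁, …))`, the linear Hamiltonian of `R`.  Hence
`Q_𝔩 + Π̄ = Φ^* S`, the twisted cotangent bundle is the transport of `(X, Q, ω)` along `Φ`, and the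
master equation for `S` is the Maurer–Cartan equation of `Π̄`.
-/

noncomputable section

namespace ShiftedPoisson

/-! ### Graded linear maps -/

section GradedModule

variable {ι R M N : Type*} [DecidableEq ι] [Semiring R] [AddCommMonoid M] [Module R M]
  [AddCommMonoid N] [Module R N]
  {ℳ : ι → Submodule R M} {𝒩 : ι → Submodule R N}

/-- The linear map `φ` preserves degrees. -/
def IsDegreeZero (ℳ : ι → Submodule R M) (𝒩 : ι → Submodule R N) (φ : M →ₗ[R] N) : Prop :=
  ∀ i, ∀ x ∈ ℳ i, φ x ∈ 𝒩 i

theorem mem_of_forall_decompose_eq_zero [DirectSum.Decomposition ℳ] {x : M} {i : ι}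
    (h : ∀ j ≠ i, (DirectSum.decompose ℳ x j : M) = 0) : x ∈ ℳ i := by
  classical
  rw [← DirectSum.sum_support_decompose ℳ x]
  refine Submodule.sum_mem _ fun j _ => ?_
  obtain rfl | hj := eq_or_ne j i
  · exact SetLike.coe_mem _
  · rw [h j hj]
    exact Submodule.zero_mem _

theorem toModule_decompose_of_mem [DirectSum.Decomposition ℳ] (φ : ∀ i, ℳ i →ₗ[R] N) {x : M}
    {i : ι} (hx : x ∈ ℳ i) :
    DirectSum.toModule R ι N φ (DirectSum.decompose ℳ x) = φ i ⟨x, hx⟩ := by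
  rw [DirectSum.decompose_of_mem ℳ hx, ← DirectSum.lof_eq_of R, DirectSum.toModule_lof]

theorem IsDegreeZero.decompose_apply [DirectSum.Decomposition ℳ] [DirectSum.Decomposition 𝒩]
    {φ : M →ₗ[R] N} (hφ : IsDegreeZero ℳ 𝒩 φ) (x : M) (i : ι) :
    (DirectSum.decompose 𝒩 (φ x) i : N) = φ (DirectSum.decompose ℳ x i) := by
  induction x using DirectSum.Decomposition.inductionOn ℳ with
  | zero => simp
  | @homogeneous j x =>
    obtain rfl | h := eq_or_ne j i
    · rw [DirectSum.decompose_of_mem_same _ (hφ j _ x.2), DirectSum.decompose_of_mem_same _ x.2]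
    · rw [DirectSum.decompose_of_mem_ne _ (hφ j _ x.2) h, DirectSum.decompose_of_mem_ne _ x.2 h,
        map_zero]
  | add x y hx hy => simp [hx, hy]

theorem IsDegreeZero.mem_iff [DirectSum.Decomposition ℳ] [DirectSum.Decomposition 𝒩]
    {φ : M →ₗ[R] N} (hφ : IsDegreeZero ℳ 𝒩 φ) (hinj : Function.Injective φ) {x : M} {i : ι} :
    φ x ∈ 𝒩 i ↔ x ∈ ℳ i := by
  refine ⟨fun hx => mem_of_forall_decompose_eq_zero fun j hj => hinj ?_, hφ i x⟩
  rw [map_zero, ← hφ.decompose_apply, DirectSum.decompose_of_mem_ne _ hx hj.symm]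

theorem IsDegreeZero.isHomogeneous_range [DirectSum.Decomposition ℳ] [DirectSum.Decomposition 𝒩]
    {φ : M →ₗ[R] N} (hφ : IsDegreeZero ℳ 𝒩 φ) :
    DirectSum.SetLike.IsHomogeneous 𝒩 (LinearMap.range φ) := by
  rintro i _ ⟨x, rfl⟩
  exact ⟨DirectSum.decompose ℳ x i, (hφ.decompose_apply x i).symm⟩

end GradedModule

theorem multilinearMap_ext_homogeneous {ι κ R M N : Type*} [DecidableEq ι] [Finite κ]
    [CommSemiring R] [AddCommMonoid M] [Module R M] [AddCommMonoid N] [Module R N]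
    (ℳ : ι → Submodule R M) [DirectSum.Decomposition ℳ]
    {F G : MultilinearMap R (fun _ : κ => M) N}
    (h : ∀ (a : κ → ι) (v : κ → M), (∀ l, v l ∈ ℳ (a l)) → F v = G v) : F = G := by
  classical
  have := Fintype.ofFinite κ
  ext v
  have hv : v = fun l => ∑ i ∈ (DirectSum.decompose ℳ (v l)).support,
      (DirectSum.decompose ℳ (v l) i : M) :=
    funext fun l => (DirectSum.sum_support_decompose ℳ (v l)).symm
  rw [hv, F.map_sum_finset, G.map_sum_finset]
  exact Finset.sum_congr rfl fun a _ => h a _ fun l => SetLike.coe_mem _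

theorem mem_and_mem_of_add_mem {ι R M : Type*} [DecidableEq ι] [Ring R] [AddCommGroup M]
    [Module R M] {ℳ : ι → Submodule R M} [DirectSum.Decomposition ℳ] {p q : Submodule R M}
    (hp : DirectSum.SetLike.IsHomogeneous ℳ p) (hq : DirectSum.SetLike.IsHomogeneous ℳ q)
    (hpq : Disjoint p q) {x y : M} (hx : x ∈ p) (hy : y ∈ q) {i : ι} (hxy : x + y ∈ ℳ i) :
    x ∈ ℳ i ∧ y ∈ ℳ i := by
  have hx' : x ∈ ℳ i := mem_of_forall_decompose_eq_zero fun j hj => by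
    have hsum : (DirectSum.decompose ℳ x j : M) + DirectSum.decompose ℳ y j = 0 := by
      rw [← Submodule.coe_add, ← DirectSum.add_apply, ← DirectSum.decompose_add,
        DirectSum.decompose_of_mem_ne _ hxy hj.symm]
    refine Submodule.disjoint_def.1 hpq _ (hp j hx) ?_
    rw [eq_neg_of_add_eq_zero_left hsum]
    exact q.neg_mem (hq j hy)
  exact ⟨hx', ((ℳ i).add_mem_iff_right hx').1 hxy⟩

theorem IsDegreeZero.exists_leftInverse {ι k V W : Type*} [DecidableEq ι] [DivisionRing k]
    [AddCommGroup V] [Module k V] [AddCommGroup W] [Module k W] {𝒱 : ι → Submodule k V}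
    {𝒲 : ι → Submodule k W} [DirectSum.Decomposition 𝒱] [DirectSum.Decomposition 𝒲]
    {φ : V →ₗ[k] W} (hφ : IsDegreeZero 𝒱 𝒲 φ) (hinj : Function.Injective φ) :
    ∃ ψ : W →ₗ[k] V, IsDegreeZero 𝒲 𝒱 ψ ∧ ∀ v, ψ (φ v) = v := by
  have hker (i : ι) : LinearMap.ker (φ.restrict (hφ i)) = ⊥ :=
    LinearMap.ker_eq_bot.2 fun v w h => Subtype.ext (hinj (congrArg Subtype.val h))
  choose ψ hψ using fun i => (φ.restrict (hφ i)).exists_leftInverse_of_injective (hker i)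
  let Ψ : W →ₗ[k] V := DirectSum.toModule k ι V (fun i => (𝒱 i).subtype ∘ₗ ψ i) ∘ₗ
    (DirectSum.decomposeLinearEquiv 𝒲).toLinearMap
  have hΨ {i : ι} {w : W} (hw : w ∈ 𝒲 i) : Ψ w = ψ i ⟨w, hw⟩ := toModule_decompose_of_mem _ hw
  refine ⟨Ψ, fun i w hw => hΨ hw ▸ (ψ i _).2, LinearMap.congr_fun (f := Ψ ∘ₗ φ)
    (g := LinearMap.id) (DirectSum.decompose_lhom_ext 𝒱 fun i => LinearMap.ext fun v => ?_)⟩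
  exact (hΨ (hφ i _ v.2)).trans (congrArg Subtype.val (LinearMap.congr_fun (hψ i) v))

variable {k : Type*} [Field k]
variable {V : Type*} [AddCommGroup V] [Module k V]
variable {W : Type*} [AddCommGroup W] [Module k W]

theorem IsDegreeZero.map_signTwist {𝒱 : ℤ → Submodule k V} {𝒲 : ℤ → Submodule k W}
    [DirectSum.Decomposition 𝒱] [DirectSum.Decomposition 𝒲] {φ : V →ₗ[k] W}
    (hφ : IsDegreeZero 𝒱 𝒲 φ) (m : ℤ) (v : V) :
    φ (signTwist 𝒱 m v) = signTwist 𝒲 m (φ v) := by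
  induction v using DirectSum.Decomposition.inductionOn 𝒱 with
  | zero => simp
  | homogeneous v =>
    rw [signTwist_of_mem 𝒱 m v.2, signTwist_of_mem 𝒲 m (hφ _ _ v.2), φ.map_smul_of_tower]
  | add v w hv hw => simp only [map_add, hv, hw]

theorem parityProj_of_mem {𝒱 : ℤ → Submodule k V} [DirectSum.Decomposition 𝒱] (e : Fin 2) {i : ℤ}
    {v : V} (hv : v ∈ 𝒱 i) : parityProj 𝒱 e v = if i % 2 = ((e : ℕ) : ℤ) then v else 0 := by
  refine (toModule_decompose_of_mem _ hv).trans ?_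
  split_ifs <;> rfl

/-! ### Graded antisymmetric pairings -/

/-- `ω` is a graded antisymmetric pairing of degree `n`: the part of the structure of an `n`-shifted
symplectic form that makes no reference to a vector field. -/
structure IsShiftedPairing (n : ℤ) (𝒱 : ℤ → Submodule k V) (ω : LinearMap.BilinForm k V) :
    Prop where
  degree : ∀ (i j : ℤ), ∀ x ∈ 𝒱 i, ∀ y ∈ 𝒱 j, i + j ≠ -n → ω x y = 0
  antisymm : ∀ (i j : ℤ), ∀ x ∈ 𝒱 i, ∀ y ∈ 𝒱 j, ω x y = -((i * j).negOnePow • ω y x)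

theorem IsShiftedSymplectic.isShiftedPairing {n : ℤ} {𝒱 : ℤ → Submodule k V} {Q : FormalMap k V V}
    {ω : LinearMap.BilinForm k V} (hω : IsShiftedSymplectic n 𝒱 Q ω) : IsShiftedPairing n 𝒱 ω where
  degree := hω.degree
  antisymm := hω.antisymm

namespace IsShiftedPairing

variable {n : ℤ} {𝒱 : ℤ → Submodule k V} [DirectSum.Decomposition 𝒱] {ω : LinearMap.BilinForm k V}

theorem apply_eq_neg_apply_signTwist (hω : IsShiftedPairing n 𝒱 ω) (x y : V) :
    ω x y = -ω (signTwist 𝒱 (n + 1) y) x := by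
  induction x using DirectSum.Decomposition.inductionOn 𝒱 with
  | zero => simp
  | add x₁ x₂ h₁ h₂ => rw [map_add, LinearMap.add_apply, h₁, h₂, map_add, neg_add]
  | @homogeneous i x =>
    induction y using DirectSum.Decomposition.inductionOn 𝒱 with
    | zero => simp
    | add y₁ y₂ h₁ h₂ => rw [map_add, h₁, h₂, map_add, map_add, LinearMap.add_apply, neg_add]
    | @homogeneous j y =>
      rw [signTwist_of_mem 𝒱 _ y.2, LinearMap.map_smul_of_tower, LinearMap.smul_apply]
      by_cases h : i + j = -n
      · obtain rfl : i = -n - j := by lia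
        have hsign : ((-n - j) * j).negOnePow = ((n + 1) * j).negOnePow := by
          rw [Int.negOnePow_eq_iff,
            show (-n - j) * j - (n + 1) * j = -(j * (j + 1)) - 2 * (n * j) by ring]
          exact (Int.even_mul_succ_self j).neg.sub (even_two_mul _)
        rw [hω.antisymm _ j x x.2 y y.2, hsign]
      · rw [hω.degree i j x x.2 y y.2 h, hω.degree j i y y.2 x x.2 (by lia), smul_zero, neg_zero]

theorem apply_decompose (hω : IsShiftedPairing n 𝒱 ω) (x y : V) (i : ℤ) :
    ω (DirectSum.decompose 𝒱 x i) y = ω x (DirectSum.decompose 𝒱 y (-n - i)) := by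
  induction x using DirectSum.Decomposition.inductionOn 𝒱 with
  | zero => simp
  | add x₁ x₂ h₁ h₂ => simp [h₁, h₂]
  | @homogeneous j x =>
    induction y using DirectSum.Decomposition.inductionOn 𝒱 with
    | zero => simp
    | add y₁ y₂ h₁ h₂ =>
      rw [map_add, h₁, h₂, DirectSum.decompose_add, DirectSum.add_apply, Submodule.coe_add, map_add]
    | @homogeneous l y =>
      simp only [DirectSum.decompose_coe, DirectSum.coe_of_apply]
      split_ifs
      · rfl
      · rw [hω.degree j l x x.2 y y.2 (by lia), ZeroMemClass.coe_zero, map_zero]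
      · rw [hω.degree j l x x.2 y y.2 (by lia), ZeroMemClass.coe_zero, map_zero,
          LinearMap.zero_apply]
      · simp

theorem mem_of_forall_apply_eq_zero (hω : IsShiftedPairing n 𝒱 ω) (hnd : ω.Nondegenerate) {x : V}
    {i : ℤ} (h : ∀ j ≠ -n - i, ∀ y ∈ 𝒱 j, ω x y = 0) : x ∈ 𝒱 i := by
  refine mem_of_forall_decompose_eq_zero fun l hl => hnd.1 _ fun y => ?_
  rw [hω.apply_decompose]
  exact h _ (by lia) _ (SetLike.coe_mem _)

theorem exists_isDegreeZero_apply_eq [FiniteDimensional k V] (hω : IsShiftedPairing n 𝒱 ω)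
    (hnd : ω.Nondegenerate) (B : LinearMap.BilinForm k V)
    (hB : ∀ (i j : ℤ), ∀ x ∈ 𝒱 i, ∀ y ∈ 𝒱 j, i + j ≠ -n → B x y = 0) :
    ∃ θ : V →ₗ[k] V, IsDegreeZero 𝒱 𝒱 θ ∧ ∀ x y, ω (θ x) y = B x y := by
  have hθ (x y : V) : ω ((ω.toDual hnd).symm (B x)) y = B x y :=
    LinearMap.BilinForm.apply_toDual_symm_apply (hB := hnd) _ _
  refine ⟨(ω.toDual hnd).symm.toLinearMap ∘ₗ B, fun i x hx => ?_, hθ⟩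
  exact hω.mem_of_forall_apply_eq_zero hnd fun j hj y hy =>
    (hθ x y).trans (hB i j x hx y hy (by lia))

end IsShiftedPairing

/-! ### Isotropic complements of a Lagrangian -/

theorem isIdempotentElem_sub {A : Type*} [Ring A] {p θ : A} (hp : IsIdempotentElem p)
    (hpθ : p * θ = 0) (hθp : θ * p = θ) : IsIdempotentElem (p - θ) := by
  have hθθ : θ * θ = 0 := by rw [← hθp, mul_assoc, ← mul_assoc p, hpθ, zero_mul, mul_zero]
  rw [IsIdempotentElem, mul_sub, sub_mul, sub_mul, hp.eq, hpθ, hθp, hθθ, sub_zero, sub_zero]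

theorem isCompl_ker_range_sub {A M : Type*} [Ring A] [AddCommGroup M] [Module A M]
    {p θ : M →ₗ[A] M} (hp : IsIdempotentElem p) (hpθ : p * θ = 0) (hθp : θ * p = θ) :
    IsCompl (LinearMap.ker p) (LinearMap.range (p - θ)) := by
  have hker : LinearMap.ker (p - θ) = LinearMap.ker p := by
    have h : p * (p - θ) = p := by rw [mul_sub, hp.eq, hpθ, sub_zero]
    have h' : (p - θ) * p = p - θ := by rw [sub_mul, hp.eq, hθp]
    refine le_antisymm ?_ ?_
    · conv_rhs => rw [← h]
      exact LinearMap.ker_le_ker_comp _ _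
    · conv_rhs => rw [← h']
      exact LinearMap.ker_le_ker_comp _ _
  rw [← hker]
  exact (LinearMap.IsIdempotentElem.isCompl (isIdempotentElem_sub hp hpθ hθp)).symm

section Lagrangian

variable {T : Type*} [AddCommGroup T] [Module k T] {n : ℤ} {𝒯 : ℤ → Submodule k T}
  [DirectSum.Decomposition 𝒯] {𝒱 : ℤ → Submodule k V} [DirectSum.Decomposition 𝒱]
  {ω : LinearMap.BilinForm k T} {f : V →ₗ[k] T}

theorem isIsotropicComplement_range_sub [NeZero (2 : k)] (hω : IsShiftedPairing n 𝒯 ω)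
    {p θ : T →ₗ[k] T} (hp : IsDegreeZero 𝒯 𝒯 p) (hpp : IsIdempotentElem p)
    (hker : LinearMap.ker p = LinearMap.range f) (hθ : IsDegreeZero 𝒯 𝒯 θ)
    (hθω : ∀ x y, ω (θ x) y = ω (p x) (p y)) (hpθ : p * θ = 0) (hθp : θ * p = θ) :
    IsIsotropicComplement 𝒯 ω f (LinearMap.range (p - (2⁻¹ : k) • θ)) where
  homogeneous := IsDegreeZero.isHomogeneous_range (ℳ := 𝒯) fun i x hx =>
    (𝒯 i).sub_mem (hp i x hx) ((𝒯 i).smul_mem _ (hθ i x hx))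
  isCompl := hker ▸ isCompl_ker_range_sub hpp (by rw [mul_smul_comm, hpθ, smul_zero])
    (by rw [smul_mul_assoc, hθp])
  isotropic := by
    rintro _ ⟨x, rfl⟩ _ ⟨y, rfl⟩
    have hpp' (z : T) : p (p z) = p z := LinearMap.congr_fun hpp z
    have hpθ' (z : T) : p (θ z) = 0 := LinearMap.congr_fun hpθ z
    have hωθ : ω (p x) (θ y) = ω (p x) (p y) := by
      rw [hω.apply_eq_neg_apply_signTwist, ← hθ.map_signTwist, hθω, hpp', hp.map_signTwist,
        ← hω.apply_eq_neg_apply_signTwist]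
    simp only [LinearMap.sub_apply, LinearMap.smul_apply, map_sub, map_smul, hωθ, hθω, hpp',
      hpθ', map_zero, smul_eq_mul]
    linear_combination (-ω (p x) (p y)) * inv_mul_cancel₀ (two_ne_zero (α := k))

theorem exists_isIsotropicComplement [NeZero (2 : k)] [FiniteDimensional k T]
    (hω : IsShiftedPairing n 𝒯 ω) (hnd : ω.Nondegenerate) (hf : IsDegreeZero 𝒱 𝒯 f)
    (hL : IsRegularEmbeddedLagrangian ω f) :
    ∃ C : Submodule k T, IsIsotropicComplement 𝒯 ω f C := by
  obtain ⟨g, hg, hgf⟩ := hf.exists_leftInverse hL.injective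
  let p : T →ₗ[k] T := LinearMap.id - f ∘ₗ g
  have hpf (a : V) : p (f a) = 0 := by simp [p, hgf]
  have hp : IsDegreeZero 𝒯 𝒯 p := fun i x hx => (𝒯 i).sub_mem hx (hf i _ (hg i x hx))
  have hpp (x : T) : p (p x) = p x := by
    conv_lhs => rw [show p x = x - f (g x) from rfl, map_sub, hpf, sub_zero]
  have hker : LinearMap.ker p = LinearMap.range f := by
    refine le_antisymm (fun x hx => ⟨g x, (sub_eq_zero.1 hx).symm⟩) ?_
    rintro _ ⟨a, rfl⟩
    exact hpf a
  obtain ⟨θ, hθ, hθω⟩ := hω.exists_isDegreeZero_apply_eq hnd (ω.compl₁₂ p p)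
    fun i j x hx y hy => hω.degree i j _ (hp i x hx) _ (hp j y hy)
  have hθf (x : T) (a : V) : ω (f a) (θ x) = 0 := by
    rw [hω.apply_eq_neg_apply_signTwist, ← hθ.map_signTwist, hθω, LinearMap.compl₁₂_apply, hpf,
      map_zero, neg_zero]
  have hpθ : p * θ = 0 := LinearMap.ext fun x => hker.ge (hL.coisotropic _ (hθf x))
  have hθp : θ * p = θ := LinearMap.ext fun x => LinearMap.ker_eq_bot.1
    (LinearMap.BilinForm.Nondegenerate.ker_eq_bot hnd) <| LinearMap.ext fun y => by
      rw [Module.End.mul_apply, hθω, hθω, LinearMap.compl₁₂_apply, hpp, LinearMap.compl₁₂_apply]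
  exact ⟨_, isIsotropicComplement_range_sub hω hp (LinearMap.ext hpp) hker hθ hθω hpθ hθp⟩

end Lagrangian

variable {U : Type*} [AddCommGroup U] [Module k U]
variable {U' : Type*} [AddCommGroup U'] [Module k U']

/-! ### Formal maps -/

section FormalMap

variable {𝒱 : ℤ → Submodule k V} {𝒲 : ℤ → Submodule k W} {𝒰 : ℤ → Submodule k U} {d : ℤ}

/-- The pullback `φ^* F = F ∘ φ` of a formal map along a linear map. -/
def pullback (φ : V →ₗ[k] W) (F : FormalMap k W U) : FormalMap k V U :=
  fun r => (F r).compLinearMap fun _ => φ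

theorem pullback_apply (φ : V →ₗ[k] W) (F : FormalMap k W U) {r : ℕ} (v : Fin r → V) :
    pullback φ F r v = F r (φ ∘ v) := rfl

theorem IsGradedFormalMap.pullback {φ : V →ₗ[k] W} (hφ : IsDegreeZero 𝒱 𝒲 φ)
    {F : FormalMap k W U} (hF : IsGradedFormalMap 𝒲 𝒰 d F) :
    IsGradedFormalMap 𝒱 𝒰 d (pullback φ F) where
  degree r a v hv := hF.degree r a (φ ∘ v) fun i => hφ _ _ (hv i)
  symm r a v hv := hF.symm r a (φ ∘ v) fun i => hφ _ _ (hv i)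

theorem IsGradedFormalMap.sum {κ : Type*} {s : ℕ → Finset κ} {F : κ → FormalMap k V W}
    (hF : ∀ l, IsGradedFormalMap 𝒱 𝒲 d (F l)) :
    IsGradedFormalMap 𝒱 𝒲 d fun r => ∑ l ∈ s r, F l r where
  degree r a v hv := by
    rw [sum_apply]
    exact Submodule.sum_mem _ fun l _ => (hF l).degree r a v hv
  symm r a v hv i j hij := by
    rw [sum_apply, sum_apply, Finset.smul_sum]
    exact Finset.sum_congr rfl fun l _ => (hF l).symm r a v hv i j hij

theorem map_derivAlong {F : FormalMap k V U} {G : FormalMap k W U'} {X : FormalMap k V V}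
    {Y : FormalMap k W W} (φ : V →ₗ[k] W) (ψ : U →ₗ[k] U')
    (hX : ∀ r v, φ (X r v) = Y r fun i => φ (v i)) (hF : ∀ r v, ψ (F r v) = G r fun i => φ (v i))
    {r : ℕ} (a : Fin r → ℤ) (v : Fin r → V) :
    ψ (derivAlong F X a v) = derivAlong G Y a (φ ∘ v) := by
  rw [derivAlong, derivAlong, map_sum]
  refine Finset.sum_congr rfl fun A _ => ?_
  rw [ψ.map_smul_of_tower, hF]
  refine congrArg (fun w => koszulSign a A • G _ w) ((Fin.comp_cons φ _ _).trans ?_)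
  rw [hX]
  rfl

theorem forall_snoc_mem {r : ℕ} {a : Fin r → ℤ} {v : Fin r → V} (hv : ∀ i, v i ∈ 𝒱 (a i)) {b : ℤ}
    {x : V} (hx : x ∈ 𝒱 b) (i : Fin (r + 1)) :
    Fin.snoc (α := fun _ => V) v x i ∈ 𝒱 (Fin.snoc (α := fun _ => ℤ) a b i) := by
  induction i using Fin.lastCases <;> simp [hx, hv]

theorem forall_insertNth_mem {r : ℕ} {a : Fin r → ℤ} {v : Fin r → V} (hv : ∀ i, v i ∈ 𝒱 (a i))
    {b : ℤ} {x : V} (hx : x ∈ 𝒱 b) (p i : Fin (r + 1)) :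
    p.insertNth (α := fun _ => V) x v i ∈ 𝒱 (p.insertNth (α := fun _ => ℤ) b a i) := by
  induction i using p.succAboveCases <;> simp [hx, hv]

theorem IsGradedFormalMap.apply_snoc_mem {F : FormalMap k V W} (hF : IsGradedFormalMap 𝒱 𝒲 d F)
    {r : ℕ} {a : Fin r → ℤ} {v : Fin r → V} (hv : ∀ i, v i ∈ 𝒱 (a i)) {b : ℤ} {x : V}
    (hx : x ∈ 𝒱 b) : F (r + 1) (Fin.snoc v x) ∈ 𝒲 (∑ i, a i + b + d) := by
  simpa [Fin.sum_univ_castSucc] using hF.degree (r + 1) _ _ (forall_snoc_mem hv hx)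

theorem succAbove_castSucc_eq_succAbove_succ {r : ℕ} {i j : Fin r} (h : j ≠ i) :
    i.castSucc.succAbove j = i.succ.succAbove j := by
  grind [Fin.succAbove]

theorem insertNth_castSucc_eq_comp_swap {α : Type*} {r : ℕ} (i : Fin r) (x : α) (v : Fin r → α) :
    i.castSucc.insertNth (α := fun _ => α) x v =
      i.succ.insertNth (α := fun _ => α) x v ∘ Equiv.swap i.castSucc i.succ := by
  refine Fin.insertNth_eq_iff.2 ⟨by simp, funext fun j => ?_⟩
  rw [Fin.removeNth_apply, Function.comp_apply]
  obtain rfl | hj := eq_or_ne j i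
  · rw [Fin.succAbove_castSucc_self, Equiv.swap_apply_right]
    conv_rhs => rw [← Fin.succAbove_succ_self j, Fin.insertNth_apply_succAbove]
  · rw [succAbove_castSucc_eq_succAbove_succ hj, Equiv.swap_apply_of_ne_of_ne
      (succAbove_castSucc_eq_succAbove_succ hj ▸ Fin.succAbove_ne _ _) (Fin.succAbove_ne _ _),
      Fin.insertNth_apply_succAbove]

theorem IsGradedFormalMap.apply_insertNth_castSucc {F : FormalMap k V W}
    (hF : IsGradedFormalMap 𝒱 𝒲 d F) {r : ℕ} {a : Fin r → ℤ} {v : Fin r → V}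
    (hv : ∀ i, v i ∈ 𝒱 (a i)) {b : ℤ} {x : V} (hx : x ∈ 𝒱 b) (i : Fin r) :
    F (r + 1) (i.castSucc.insertNth (α := fun _ => V) x v) =
      (b * a i).negOnePow • F (r + 1) (i.succ.insertNth (α := fun _ => V) x v) := by
  have ha : i.succ.insertNth (α := fun _ => ℤ) b a i.castSucc = a i := by
    conv_lhs => rw [← Fin.succAbove_succ_self i, Fin.insertNth_apply_succAbove]
  rw [insertNth_castSucc_eq_comp_swap, hF.symm _ _ _ (forall_insertNth_mem hv hx i.succ) _ _ rfl,
    ha, Fin.insertNth_apply_same, mul_comm]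

theorem filter_castSucc_le_castSucc {r : ℕ} (i : Fin r) :
    (Finset.univ.filter fun j : Fin r => i.castSucc ≤ j.castSucc) =
      insert i (Finset.univ.filter fun j : Fin r => i.succ ≤ j.castSucc) := by
  ext j
  grind [Fin.le_def]

theorem IsGradedFormalMap.apply_insertNth {F : FormalMap k V W} (hF : IsGradedFormalMap 𝒱 𝒲 d F)
    {r : ℕ} {a : Fin r → ℤ} {v : Fin r → V} (hv : ∀ i, v i ∈ 𝒱 (a i)) {b : ℤ} {x : V}
    (hx : x ∈ 𝒱 b) (i : Fin (r + 1)) :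
    F (r + 1) (i.insertNth (α := fun _ => V) x v) =
      (b * ∑ j with i ≤ Fin.castSucc j, a j).negOnePow • F (r + 1) (Fin.snoc v x) := by
  induction i using Fin.reverseInduction with
  | last => simp [Fin.insertNth_last']
  | cast i ih =>
    rw [hF.apply_insertNth_castSucc hv hx, ih, smul_smul, ← Int.negOnePow_add,
      filter_castSucc_le_castSucc, Finset.sum_insert (by simp [Fin.le_def]), mul_add]

theorem IsGradedFormalMap.apply_cons {F : FormalMap k V W} (hF : IsGradedFormalMap 𝒱 𝒲 d F)
    {r : ℕ} {a : Fin r → ℤ} {v : Fin r → V} (hv : ∀ i, v i ∈ 𝒱 (a i)) {b : ℤ} {x : V}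
    (hx : x ∈ 𝒱 b) :
    F (r + 1) (Fin.cons x v) = (b * ∑ j, a j).negOnePow • F (r + 1) (Fin.snoc v x) := by
  simpa [Fin.insertNth_zero'] using hF.apply_insertNth hv hx 0

end FormalMap

/-! ### Sums over unshuffles -/

section Unshuffle

theorem strictMono_snoc {α : Type*} [Preorder α] {r : ℕ} {f : Fin r → α} (hf : StrictMono f)
    {x : α} (hx : ∀ i, f i < x) : StrictMono (Fin.snoc (α := fun _ => α) f x) := by
  intro i j hij
  induction j using Fin.lastCases with
  | last =>
    obtain ⟨i, rfl⟩ := Fin.exists_castSucc_eq.2 hij.ne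
    simpa using hx i
  | cast j =>
    obtain ⟨i, rfl⟩ := Fin.exists_castSucc_eq.2 (hij.trans (Fin.castSucc_lt_last j)).ne
    simpa using hf (Fin.castSucc_lt_castSucc_iff.1 hij)

theorem sigma_orderEmbOfFin_eq {r p : ℕ} {A : Finset (Fin r)} {e : Fin p → Fin r}
    (he : StrictMono e) (hA : Set.range e = A) :
    (⟨A.card, A.orderEmbOfFin rfl⟩ : Σ p, Fin p → Fin r) = ⟨p, e⟩ := by
  obtain rfl : A.card = p := by
    rw [← Set.ncard_coe_finset, ← hA, ← Set.image_univ, Set.ncard_image_of_injective _ he.injective,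
      Set.ncard_univ, Nat.card_fin]
  have hmem (x) : e x ∈ A := Finset.mem_coe.1 (hA ▸ Set.mem_range_self x)
  rw [Finset.orderEmbOfFin_unique rfl hmem he]

variable {r : ℕ} (A : Finset (Fin r))

theorem compl_map_castSucc :
    (A.map Fin.castSuccEmb)ᶜ = insert (Fin.last r) (Aᶜ.map Fin.castSuccEmb) := by
  ext i
  induction i using Fin.lastCases <;> simp [Fin.castSucc_ne_last]

theorem compl_insert_last_map_castSucc :
    (insert (Fin.last r) (A.map Fin.castSuccEmb))ᶜ = Aᶜ.map Fin.castSuccEmb := by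
  ext i
  induction i using Fin.lastCases <;> simp [Fin.castSucc_ne_last]

theorem sigma_orderEmbOfFin_map_castSucc :
    (⟨(A.map Fin.castSuccEmb).card, (A.map Fin.castSuccEmb).orderEmbOfFin rfl⟩ :
      Σ p, Fin p → Fin (r + 1)) = ⟨A.card, Fin.castSucc ∘ A.orderEmbOfFin rfl⟩ :=
  sigma_orderEmbOfFin_eq (Fin.strictMono_castSucc.comp (A.orderEmbOfFin rfl).strictMono)
    (by simp [Set.range_comp])

theorem sigma_orderEmbOfFin_insert_last :
    (⟨(insert (Fin.last r) (A.map Fin.castSuccEmb)).card,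
        (insert (Fin.last r) (A.map Fin.castSuccEmb)).orderEmbOfFin rfl⟩ :
      Σ p, Fin p → Fin (r + 1)) =
    ⟨A.card + 1, Fin.snoc (α := fun _ => Fin (r + 1)) (Fin.castSucc ∘ A.orderEmbOfFin rfl)
      (Fin.last r)⟩ := by
  refine sigma_orderEmbOfFin_eq ?_ (by simp [Fin.range_snoc, Set.range_comp])
  exact strictMono_snoc (Fin.strictMono_castSucc.comp (A.orderEmbOfFin rfl).strictMono)
    fun i => Fin.castSucc_lt_last _

end Unshuffle

theorem sum_finset_fin_succ {M : Type*} [AddCommMonoid M] {r : ℕ} (φ : Finset (Fin (r + 1)) → M) :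
    ∑ A, φ A = ∑ A : Finset (Fin r), φ (A.map Fin.castSuccEmb) +
      ∑ A : Finset (Fin r), φ (insert (Fin.last r) (A.map Fin.castSuccEmb)) := by
  have hpow (ψ : Finset (Fin (r + 1)) → M) :
      ∑ A ∈ (Finset.univ.map (Fin.castSuccEmb (n := r))).powerset, ψ A =
        ∑ A : Finset (Fin r), ψ (A.map Fin.castSuccEmb) := by
    simp only [Finset.map_eq_image, Finset.powerset_image, Finset.powerset_univ]
    exact Finset.sum_image (Finset.image_injective (Fin.castSuccEmb (n := r)).injective).injOn
  rw [← Finset.powerset_univ, Fin.univ_castSuccEmb, Finset.cons_eq_insert,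
    Finset.sum_powerset_insert (by simp [Fin.castSucc_ne_last]), hpow, hpow]

theorem prod_negOnePow {ι : Type*} (s : Finset ι) (g : ι → ℤ) :
    ∏ i ∈ s, (g i).negOnePow = (∑ i ∈ s, g i).negOnePow := by
  classical
  induction s using Finset.induction_on with
  | empty => simp
  | insert i s hi ih => rw [Finset.prod_insert hi, Finset.sum_insert hi, ih, Int.negOnePow_add]

section KoszulSign

variable {r : ℕ} (a : Fin r → ℤ) (b : ℤ) (A : Finset (Fin r))

theorem koszulSign_eq_negOnePow_sum :
    koszulSign a A = (∑ i ∈ A, ∑ j ∈ Aᶜ with j < i, a i * a j).negOnePow := by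
  simp only [koszulSign, prod_negOnePow]

theorem koszulSign_mul_compl :
    koszulSign a A * koszulSign a Aᶜ = ((∑ i ∈ A, a i) * ∑ i ∈ Aᶜ, a i).negOnePow := by
  have hswap : ∑ i ∈ Aᶜ, ∑ j ∈ A with j < i, a i * a j =
      ∑ i ∈ A, ∑ j ∈ Aᶜ with ¬j < i, a i * a j := by
    simp only [Finset.sum_filter]
    rw [Finset.sum_comm]
    refine Finset.sum_congr rfl fun i hi => Finset.sum_congr rfl fun j hj => ?_
    have hij : i ≠ j := fun h => Finset.mem_compl.1 hj (h ▸ hi)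
    simp only [mul_comm (a j), not_lt, hij.le_iff_lt]
  rw [koszulSign_eq_negOnePow_sum, koszulSign_eq_negOnePow_sum, ← Int.negOnePow_add, compl_compl,
    hswap, ← Finset.sum_add_distrib, Finset.sum_mul_sum]
  simp only [Finset.sum_filter_add_sum_filter_not]

theorem koszulSign_snoc_map_castSucc :
    koszulSign (Fin.snoc (α := fun _ => ℤ) a b) (A.map Fin.castSuccEmb) = koszulSign a A := by
  rw [koszulSign, koszulSign, Finset.prod_map, compl_map_castSucc]
  refine Finset.prod_congr rfl fun i _ => ?_
  have hlast : ¬Fin.last r < Fin.castSuccEmb i := (Fin.castSucc_lt_last i).not_gt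
  rw [Finset.filter_insert, if_neg hlast, Finset.filter_map, Finset.prod_map]
  simp [Function.comp_def]

theorem koszulSign_snoc_insert_last :
    koszulSign (Fin.snoc (α := fun _ => ℤ) a b) (insert (Fin.last r) (A.map Fin.castSuccEmb)) =
      (b * ∑ j ∈ Aᶜ, a j).negOnePow * koszulSign a A := by
  rw [koszulSign, compl_insert_last_map_castSucc,
    Finset.prod_insert (by simp [Fin.castSucc_ne_last]), Finset.prod_map, koszulSign]
  simp only [Finset.filter_map, Finset.prod_map]
  simp [Function.comp_def, Fin.castSucc_lt_last, prod_negOnePow, Finset.mul_sum]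

end KoszulSign

theorem derivAlong_term_eq (F : FormalMap k V W) (X : FormalMap k V V) {r : ℕ} (v : Fin r → V)
    {A B : Finset (Fin r)} {s t : Σ p, Fin p → Fin r}
    (hA : (⟨A.card, A.orderEmbOfFin rfl⟩ : Σ p, Fin p → Fin r) = s)
    (hB : (⟨B.card, B.orderEmbOfFin rfl⟩ : Σ p, Fin p → Fin r) = t) :
    F (B.card + 1) (Fin.cons (X A.card (v ∘ A.orderEmbOfFin rfl)) (v ∘ B.orderEmbOfFin rfl)) =
      F (t.1 + 1) (Fin.cons (X s.1 (v ∘ s.2)) (v ∘ t.2)) := by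
  subst hA hB
  rfl

theorem derivAlong_snoc (F : FormalMap k V W) (X : FormalMap k V V) {r : ℕ} (a : Fin r → ℤ)
    (v : Fin r → V) (b : ℤ) (w : V) :
    derivAlong F X (Fin.snoc (α := fun _ => ℤ) a b) (Fin.snoc (α := fun _ => V) v w) =
    ∑ A : Finset (Fin r), koszulSign a A • F (Aᶜ.card + 1 + 1)
      (Fin.snoc (α := fun _ => V)
        (Fin.cons (X A.card (v ∘ A.orderEmbOfFin rfl)) (v ∘ Aᶜ.orderEmbOfFin rfl)) w) +
    ∑ A : Finset (Fin r), ((b * ∑ j ∈ Aᶜ, a j).negOnePow * koszulSign a A) • F (Aᶜ.card + 1)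
      (Fin.cons (X (A.card + 1) (Fin.snoc (α := fun _ => V) (v ∘ A.orderEmbOfFin rfl) w))
        (v ∘ Aᶜ.orderEmbOfFin rfl)) := by
  have hcast {p : ℕ} (e : Fin p → Fin r) :
      Fin.snoc (α := fun _ => V) v w ∘ Fin.castSucc ∘ e = v ∘ e := by
    rw [← Function.comp_assoc, Fin.snoc_comp_castSucc]
  rw [derivAlong, sum_finset_fin_succ]
  congr 1 <;> refine Finset.sum_congr rfl fun A _ => ?_
  · have hcompl := sigma_orderEmbOfFin_insert_last Aᶜ
    rw [← compl_map_castSucc] at hcompl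
    rw [koszulSign_snoc_map_castSucc,
      derivAlong_term_eq F X _ (sigma_orderEmbOfFin_map_castSucc A) hcompl]
    dsimp only
    rw [hcast, Fin.comp_snoc, hcast, Fin.snoc_last, Fin.cons_snoc_eq_snoc_cons]
  · have hcompl := sigma_orderEmbOfFin_map_castSucc Aᶜ
    rw [← compl_insert_last_map_castSucc] at hcompl
    rw [koszulSign_snoc_insert_last,
      derivAlong_term_eq F X _ (sigma_orderEmbOfFin_insert_last A) hcompl]
    dsimp only
    rw [hcast, Fin.comp_snoc, hcast, Fin.snoc_last]

theorem derivAlong_eq_sum_compl (F : FormalMap k V W) (X : FormalMap k V V) {r : ℕ}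
    (a : Fin r → ℤ) (v : Fin r → V) :
    derivAlong F X a v = ∑ A : Finset (Fin r), koszulSign a Aᶜ • F (A.card + 1)
      (Fin.cons (X Aᶜ.card (v ∘ Aᶜ.orderEmbOfFin rfl)) (v ∘ A.orderEmbOfFin rfl)) :=
  (Fintype.sum_bijective compl compl_bijective _ _ fun A => congrArg
    (fun B => koszulSign a Aᶜ • F (B.card + 1)
      (Fin.cons (X Aᶜ.card (v ∘ Aᶜ.orderEmbOfFin rfl)) (v ∘ B.orderEmbOfFin rfl)))
    (compl_compl A).symm).symm

theorem sum_comp_orderEmbOfFin {M : Type*} [AddCommMonoid M] {r : ℕ} (a : Fin r → M)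
    (A : Finset (Fin r)) : ∑ i, a (A.orderEmbOfFin rfl i) = ∑ i ∈ A, a i := by
  conv_rhs => rw [← Finset.map_orderEmbOfFin_univ A rfl, Finset.sum_map]
  rfl

/-! ### The action functional -/

theorem snoc_comp_swap_castSucc {α : Type*} {r : ℕ} (v : Fin r → α) (x : α) (i j : Fin r) :
    Fin.snoc (α := fun _ => α) v x ∘ Equiv.swap i.castSucc j.castSucc =
      Fin.snoc (α := fun _ => α) (v ∘ Equiv.swap i j) x := by
  funext l
  induction l using Fin.lastCases with
  | last =>
    rw [Function.comp_apply, Equiv.swap_apply_of_ne_of_ne (Fin.castSucc_ne_last i).symm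
      (Fin.castSucc_ne_last j).symm, Fin.snoc_last, Fin.snoc_last]
  | cast l =>
    rw [Function.comp_apply, ← (Fin.castSucc_injective r).map_swap, Fin.snoc_castSucc,
      Fin.snoc_castSucc, Function.comp_apply]

theorem snoc_snoc_comp_swap_last {α : Type*} {r : ℕ} (v : Fin r → α) (x y : α) :
    Fin.snoc (α := fun _ => α) (Fin.snoc (α := fun _ => α) v x) y ∘
        Equiv.swap (Fin.last r).castSucc (Fin.last (r + 1)) =
      Fin.snoc (α := fun _ => α) (Fin.snoc (α := fun _ => α) v y) x := by
  funext l
  induction l using Fin.lastCases with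
  | last => simp
  | cast l =>
    induction l using Fin.lastCases with
    | last => simp
    | cast l =>
      rw [Function.comp_apply, Equiv.swap_apply_of_ne_of_ne
        ((Fin.castSucc_injective _).ne (Fin.castSucc_ne_last l)) (Fin.castSucc_ne_last _)]
      simp

section ActionFunctional

variable {n : ℤ} {𝒱 : ℤ → Submodule k V} {Q : FormalMap k V V} {ω : LinearMap.BilinForm k V}

theorem actionFunctional_snoc {r : ℕ} (v : Fin r → V) (w : V) :
    actionFunctional ω Q (r + 1) (Fin.snoc (α := fun _ => V) v w) = ω (Q r v) w := by
  simp [actionFunctional]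

theorem IsShiftedSymplectic.apply_apply_snoc (hω : IsShiftedSymplectic n 𝒱 Q ω) {r : ℕ}
    {a : Fin r → ℤ} {v : Fin r → V} (hv : ∀ l, v l ∈ 𝒱 (a l)) {i j : ℤ} {x y : V} (hx : x ∈ 𝒱 i)
    (hy : y ∈ 𝒱 j) :
    ω x (Q (r + 1) (Fin.snoc v y)) =
      -((i * (∑ l, a l + 1)).negOnePow • ω (Q (r + 1) (Fin.snoc v x)) y) := by
  rw [eq_neg_of_add_eq_zero_left (hω.lie_derivative r a v hv i j x hx y hy), smul_neg, neg_neg,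
    smul_smul, Int.units_mul_self, one_smul]

theorem IsShiftedSymplectic.apply_snoc_swap (hω : IsShiftedSymplectic n 𝒱 Q ω)
    (hQ : IsGradedFormalMap 𝒱 𝒱 1 Q) {r : ℕ} {a : Fin r → ℤ} {v : Fin r → V}
    (hv : ∀ l, v l ∈ 𝒱 (a l)) {i j : ℤ} {x y : V} (hx : x ∈ 𝒱 i) (hy : y ∈ 𝒱 j) :
    ω (Q (r + 1) (Fin.snoc v y)) x = (i * j).negOnePow • ω (Q (r + 1) (Fin.snoc v x)) y := by
  rw [hω.antisymm _ _ _ (hQ.apply_snoc_mem hv hy) _ hx, hω.apply_apply_snoc hv hx hy, smul_neg,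
    neg_neg, smul_smul, ← Int.negOnePow_add]
  refine congrArg (· • _) ((Int.negOnePow_eq_iff _ _).2 ?_)
  exact ⟨i * (∑ l, a l + 1), by ring⟩

theorem isGradedFormalMap_actionFunctional (hQ : IsGradedFormalMap 𝒱 𝒱 1 Q)
    (hω : IsShiftedSymplectic n 𝒱 Q ω) :
    IsGradedFormalMap 𝒱 (scalarGrading k) (n + 1) (actionFunctional ω Q) where
  degree
  | 0, _, _, _ => Submodule.zero_mem _
  | r + 1, a, v, hv => by
    rw [scalarGrading, Fin.sum_univ_castSucc]
    split_ifs
    · trivial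
    · exact hω.degree _ _ _ (hQ.degree r _ (Fin.init v) fun i => hv i.castSucc) _
        (hv (Fin.last r)) (by lia)
  symm
  | 0, _, _, _, i, _, _ => i.elim0
  | r + 1, a, v, hv, i, j, hij => by
    induction v using Fin.snocCases with | snoc v y
    induction a using Fin.snocCases with | snoc a c
    have hv' (l) : v l ∈ 𝒱 (a l) := by simpa using hv l.castSucc
    induction j using Fin.lastCases with
    | cast j =>
      obtain ⟨i, rfl⟩ := Fin.exists_castSucc_eq.2 (show i ≠ Fin.last r by grind)
      rw [snoc_comp_swap_castSucc, actionFunctional_snoc, actionFunctional_snoc,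
        hQ.symm r a v hv' i j hij, LinearMap.map_smul_of_tower, LinearMap.smul_apply,
        Fin.snoc_castSucc, Fin.snoc_castSucc]
    | last =>
      obtain _ | r := r
      · simp at hij
      obtain rfl : i = (Fin.last r).castSucc := Fin.ext (by simpa using hij)
      induction v using Fin.snocCases with | snoc v x
      induction a using Fin.snocCases with | snoc a b
      have hx : x ∈ 𝒱 b := by simpa using hv' (Fin.last r)
      have hy : y ∈ 𝒱 c := by simpa using hv (Fin.last (r + 1))
      rw [snoc_snoc_comp_swap_last, actionFunctional_snoc, actionFunctional_snoc,
        hω.apply_snoc_swap hQ (fun l => by simpa using hv' l.castSucc) hx hy]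
      simp

theorem actionFunctional_cons_snoc (hQ : IsGradedFormalMap 𝒱 𝒱 1 Q)
    (hω : IsShiftedSymplectic n 𝒱 Q ω) {p q : ℕ} {a : Fin p → ℤ} {v : Fin p → V}
    (hv : ∀ i, v i ∈ 𝒱 (a i)) {c : Fin q → ℤ} {u : Fin q → V} (hu : ∀ i, u i ∈ 𝒱 (c i)) {b : ℤ}
    {w : V} (hw : w ∈ 𝒱 b) :
    actionFunctional ω Q (q + 1) (Fin.cons (Q (p + 1) (Fin.snoc v w)) u) =
      ((∑ i, c i) * (∑ i, a i + b)).negOnePow • ω (Q (p + 1) (Fin.cons (Q q u) v)) w := by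
  have hQu := hQ.degree q c u hu
  rw [(isGradedFormalMap_actionFunctional hQ hω).apply_cons hu (hQ.apply_snoc_mem hv hw),
    actionFunctional_snoc, hω.apply_apply_snoc hv hQu hw, hQ.apply_cons hv hQu,
    LinearMap.map_smul_of_tower, LinearMap.smul_apply, smul_neg, smul_smul, smul_smul,
    ← Int.negOnePow_add, ← Int.negOnePow_add, ← Units.neg_smul, ← Int.negOnePow_succ]
  refine congrArg (· • _) ((Int.negOnePow_eq_iff _ _).2 ?_)
  exact ⟨1 + ∑ i, c i, by ring⟩

theorem derivAlong_actionFunctional_snoc (hQ : IsGradedFormalMap 𝒱 𝒱 1 Q)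
    (hω : IsShiftedSymplectic n 𝒱 Q ω) {r : ℕ} {a : Fin r → ℤ} {v : Fin r → V}
    (hv : ∀ i, v i ∈ 𝒱 (a i)) {b : ℤ} {w : V} (hw : w ∈ 𝒱 b) :
    derivAlong (actionFunctional ω Q) Q (Fin.snoc (α := fun _ => ℤ) a b)
        (Fin.snoc (α := fun _ => V) v w) =
      ω (derivAlong Q Q a v) w + ω (derivAlong Q Q a v) w := by
  -- One copy comes from the subsets avoiding the last index; invariance of `ω` exchanges `A` and
  -- `Aᶜ` in those containing it and gives the other.
  rw [derivAlong_snoc]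
  congr 1
  · rw [derivAlong, map_sum, LinearMap.sum_apply]
    refine Finset.sum_congr rfl fun A _ => ?_
    rw [actionFunctional_snoc, LinearMap.map_smul_of_tower, LinearMap.smul_apply]
  · rw [derivAlong_eq_sum_compl, map_sum, LinearMap.sum_apply]
    refine Finset.sum_congr rfl fun A _ => ?_
    have hmem (B : Finset (Fin r)) (i) : (v ∘ B.orderEmbOfFin rfl) i ∈
        𝒱 (a (B.orderEmbOfFin rfl i)) := hv _
    rw [actionFunctional_cons_snoc hQ hω (hmem A) (hmem Aᶜ) hw, LinearMap.map_smul_of_tower,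
      LinearMap.smul_apply, smul_smul, sum_comp_orderEmbOfFin, sum_comp_orderEmbOfFin]
    have hA : koszulSign a Aᶜ = koszulSign a A * ((∑ i ∈ A, a i) * ∑ i ∈ Aᶜ, a i).negOnePow := by
      rw [← koszulSign_mul_compl, ← mul_assoc, Int.units_mul_self, one_mul]
    rw [hA, mul_comm b, mul_add, Int.negOnePow_add, mul_comm (∑ i ∈ Aᶜ, a i) (∑ i ∈ A, a i),
      mul_comm (Int.negOnePow _) (Int.negOnePow _), mul_mul_mul_comm, Int.units_mul_self, one_mul]

theorem derivAlong_actionFunctional (hQ : IsFormalModuliProblem 𝒱 Q)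
    (hω : IsShiftedSymplectic n 𝒱 Q ω) {r : ℕ} {a : Fin r → ℤ} {v : Fin r → V}
    (hv : ∀ i, v i ∈ 𝒱 (a i)) : derivAlong (actionFunctional ω Q) Q a v = 0 := by
  obtain _ | r := r
  · rw [derivAlong, Finset.sum_eq_zero]
    intro A _
    obtain rfl := Finset.eq_empty_of_isEmpty A
    rw [show Q (Finset.card (∅ : Finset (Fin 0))) = 0 from hQ.pointed,
      MultilinearMap.map_coord_zero _ 0 (by rfl), smul_zero]
  induction v using Fin.snocCases with | snoc v w
  induction a using Fin.snocCases with | snoc a b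
  have hv' (i) : v i ∈ 𝒱 (a i) := by simpa using hv i.castSucc
  have hw : w ∈ 𝒱 b := by simpa using hv (Fin.last r)
  rw [derivAlong_actionFunctional_snoc hQ.graded hω hv' hw, hQ.square_zero r a v hv', map_zero,
    LinearMap.zero_apply, add_zero]

end ActionFunctional

/-! ### Hamiltonian vector fields -/

section Hamiltonian

variable [FiniteDimensional k V] {ω : LinearMap.BilinForm k V} (hω : ω.Nondegenerate)

theorem apply_hamiltonianVF (F : FormalMap k V k) {r : ℕ} (v : Fin r → V) (w : V) :
    ω (hamiltonianVF ω hω F r v) w = F (r + 1) (Fin.snoc v w) :=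
  LinearMap.BilinForm.apply_toDual_symm_apply (hB := hω) _ _

theorem hamiltonianVF_add (F G : FormalMap k V k) :
    hamiltonianVF ω hω (F + G) = hamiltonianVF ω hω F + hamiltonianVF ω hω G := by
  funext r
  ext v
  exact map_add (ω.toDual hω).symm ((F (r + 1)).curryRight v) ((G (r + 1)).curryRight v)

theorem hamiltonianVF_actionFunctional (Q : FormalMap k V V) :
    hamiltonianVF ω hω (actionFunctional ω Q) = Q := by
  funext r
  ext v
  refine sub_eq_zero.1 (hω.1 _ fun w => ?_)
  rw [map_sub, LinearMap.sub_apply, apply_hamiltonianVF, actionFunctional_snoc, sub_self]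

theorem poissonBracket_actionFunctional {n : ℤ} {𝒱 : ℤ → Submodule k V} {Q : FormalMap k V V}
    (hQ : IsFormalModuliProblem 𝒱 Q) (hωQ : IsShiftedSymplectic n 𝒱 Q ω) {r : ℕ} {a : Fin r → ℤ}
    {v : Fin r → V} (hv : ∀ i, v i ∈ 𝒱 (a i)) :
    poissonBracket ω hω (actionFunctional ω Q) (actionFunctional ω Q) a v = 0 := by
  rw [poissonBracket, hamiltonianVF_actionFunctional, derivAlong_actionFunctional hQ hωQ hv]

variable [FiniteDimensional k W] {ω' : LinearMap.BilinForm k W} (hω' : ω'.Nondegenerate)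
  {φ : W →ₗ[k] V}

theorem map_hamiltonianVF_pullback (hφ : ∀ x y, ω (φ x) (φ y) = ω' x y)
    (hsurj : Function.Surjective φ) (F : FormalMap k V k) (r : ℕ) (v : Fin r → W) :
    φ (hamiltonianVF ω' hω' (pullback φ F) r v) = hamiltonianVF ω hω F r fun i => φ (v i) := by
  refine sub_eq_zero.1 (hω.1 _ (hsurj.forall.2 fun w => ?_))
  rw [map_sub, LinearMap.sub_apply, hφ, apply_hamiltonianVF, apply_hamiltonianVF, pullback_apply,
    Fin.comp_snoc]
  exact sub_self _

theorem poissonBracket_pullback (hφ : ∀ x y, ω (φ x) (φ y) = ω' x y)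
    (hsurj : Function.Surjective φ) (F G : FormalMap k V k) {r : ℕ} (a : Fin r → ℤ)
    (v : Fin r → W) :
    poissonBracket ω' hω' (pullback φ F) (pullback φ G) a v =
      poissonBracket ω hω F G a (φ ∘ v) :=
  map_derivAlong φ LinearMap.id (map_hamiltonianVF_pullback hω hω' hφ hsurj F)
    (fun _ _ => rfl) a v

end Hamiltonian

/-! ### Transport along linear maps -/

theorem isInternal_of_linearEquiv {ι : Type*} [DecidableEq ι] {𝒲 : ι → Submodule k W}
    {𝒯 : ι → Submodule k U} (e : W ≃ₗ[k] U) (he : ∀ i x, x ∈ 𝒲 i ↔ e x ∈ 𝒯 i)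
    (h : DirectSum.IsInternal 𝒯) : DirectSum.IsInternal 𝒲 := by
  rw [DirectSum.isInternal_submodule_iff_iSupIndep_and_iSup_eq_top] at h ⊢
  obtain rfl : 𝒲 = (Submodule.orderIsoMapComap e).symm ∘ 𝒯 :=
    funext fun i => Submodule.ext (he i)
  refine ⟨h.1.map_orderIso _, ?_⟩
  rw [← map_top (Submodule.orderIsoMapComap e).symm, ← h.2, OrderIso.map_iSup]
  rfl

section Transport

variable {𝒲 : ℤ → Submodule k W} {𝒯 : ℤ → Submodule k U} {X : FormalMap k W W}
  {Q : FormalMap k U U} {φ : W →ₗ[k] U}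

theorem IsStrictMap.isGradedFormalMap (hφ : IsStrictMap 𝒲 X 𝒯 Q φ)
    (hinj : Function.Injective φ) (hmem : ∀ i x, φ x ∈ 𝒯 i → x ∈ 𝒲 i) {d : ℤ}
    (hQ : IsGradedFormalMap 𝒯 𝒯 d Q) : IsGradedFormalMap 𝒲 𝒲 d X where
  degree r a v hv := hmem _ _ <| hφ.comm r v ▸ hQ.degree r a _ fun i => hφ.degree _ _ (hv i)
  symm r a v hv i j hij := hinj <| by
    rw [φ.map_smul_of_tower, hφ.comm, hφ.comm]
    exact hQ.symm r a (φ ∘ v) (fun i => hφ.degree _ _ (hv i)) i j hij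

theorem IsStrictMap.isFormalModuliProblem (hφ : IsStrictMap 𝒲 X 𝒯 Q φ)
    (hinj : Function.Injective φ) (hmem : ∀ i x, φ x ∈ 𝒯 i → x ∈ 𝒲 i)
    (h𝒲 : DirectSum.IsInternal 𝒲) (hQ : IsFormalModuliProblem 𝒯 Q) :
    IsFormalModuliProblem 𝒲 X where
  grading := h𝒲
  graded := hφ.isGradedFormalMap hinj hmem hQ.graded
  pointed := MultilinearMap.ext fun v => hinj <| by
    rw [hφ.comm, hQ.pointed, zero_apply, zero_apply, map_zero]
  square_zero r a v hv := hinj <| by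
    rw [map_derivAlong φ φ hφ.comm hφ.comm, map_zero]
    exact hQ.square_zero r a _ fun i => hφ.degree _ _ (hv i)

theorem IsStrictMap.isShiftedSymplectic (hφ : IsStrictMap 𝒲 X 𝒯 Q φ) {n : ℤ}
    {ω : LinearMap.BilinForm k U} {ω' : LinearMap.BilinForm k W}
    (hω' : ∀ x y, ω (φ x) (φ y) = ω' x y) (hnd : ω'.Nondegenerate)
    (hω : IsShiftedSymplectic n 𝒯 Q ω) : IsShiftedSymplectic n 𝒲 X ω' where
  degree i j x hx y hy hij :=
    hω' x y ▸ hω.degree i j _ (hφ.degree _ _ hx) _ (hφ.degree _ _ hy) hij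
  antisymm i j x hx y hy := by
    rw [← hω', ← hω', hω.antisymm i j _ (hφ.degree _ _ hx) _ (hφ.degree _ _ hy)]
  nondegenerate := hnd
  lie_derivative r a v hv i j x hx y hy := by
    have hsnoc (z) : φ (X (r + 1) (Fin.snoc v z)) = Q (r + 1) (Fin.snoc (φ ∘ v) (φ z)) :=
      (hφ.comm _ _).trans (congrArg (Q (r + 1)) (Fin.comp_snoc φ v z))
    rw [← hω', ← hω', hsnoc, hsnoc]
    exact hω.lie_derivative r a _ (fun l => hφ.degree _ _ (hv l)) i j _ (hφ.degree _ _ hx) _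
      (hφ.degree _ _ hy)

end Transport

/-! ### Weights -/

theorem weightPart_apply (j : ℕ) (F : FormalMap k (V × Module.Dual k V) k) {r : ℕ}
    (u : Fin r → V × Module.Dual k V) :
    weightPart j F r u = ∑ B ∈ (Finset.univ : Finset (Fin r)).powersetCard j,
      F r fun i => if i ∈ B then (0, (u i).2) else ((u i).1, 0) := by
  rw [weightPart, sum_apply]
  refine Finset.sum_congr rfl fun B _ => congrArg (F r) (funext fun i => ?_)
  split_ifs with hi <;> simp [hi]

theorem weightPart_zero_apply (F : FormalMap k (V × Module.Dual k V) k) {r : ℕ}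
    (u : Fin r → V × Module.Dual k V) : weightPart 0 F r u = F r fun i => ((u i).1, 0) := by
  simp [weightPart_apply]

theorem weightPart_one_apply (F : FormalMap k (V × Module.Dual k V) k) {r : ℕ}
    (u : Fin (r + 1) → V × Module.Dual k V) :
    weightPart 1 F (r + 1) u = ∑ i : Fin (r + 1), F (r + 1)
      (i.insertNth (α := fun _ => V × Module.Dual k V) (0, (u i).2)
        fun j => ((u (i.succAbove j)).1, 0)) := by
  rw [weightPart_apply, Finset.powersetCard_one, Finset.sum_map]
  refine Finset.sum_congr rfl fun i _ => congrArg (F (r + 1)) (funext fun l => ?_)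
  induction l using i.succAboveCases <;> simp

theorem sum_weightPart (F : FormalMap k (V × Module.Dual k V) k) (r : ℕ) :
    ∑ j ∈ Finset.range (r + 1), weightPart j F r = F r := by
  ext u
  have hu : u = (fun i => ((0 : V), (u i).2)) + fun i => ((u i).1, (0 : Module.Dual k V)) := by
    funext i
    simp
  conv_rhs => rw [hu, MultilinearMap.map_add_univ, ← Finset.powerset_univ, Finset.sum_powerset]
  rw [sum_apply, Finset.card_univ, Fintype.card_fin]
  exact Finset.sum_congr rfl fun j _ => weightPart_apply j F u

theorem weightPart_add_weightGeTwo (F : FormalMap k (V × Module.Dual k V) k) :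
    weightPart 0 F + weightPart 1 F + weightGeTwo F = F := by
  funext r
  conv_rhs => rw [← sum_weightPart F r]
  rw [Pi.add_apply, Pi.add_apply, weightGeTwo]
  obtain _ | r := r
  · simp [show weightPart 1 F 0 = 0 from rfl]
  · have hrange : Finset.range (r + 2) = insert 0 (insert 1 (Finset.Icc 2 (r + 1))) := by grind
    rw [hrange, Finset.sum_insert (by simp), Finset.sum_insert (by simp), add_assoc]

theorem weightPart_weightGeTwo {i : ℕ} (hi : i < 2) (F : FormalMap k (V × Module.Dual k V) k) :
    weightPart i (weightGeTwo F) = 0 := by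
  funext r
  ext u
  rw [weightPart_apply]
  refine Finset.sum_eq_zero fun B hB => ?_
  rw [weightGeTwo, sum_apply]
  refine Finset.sum_eq_zero fun j hj => ?_
  rw [weightPart_apply]
  refine Finset.sum_eq_zero fun B' hB' => ?_
  obtain ⟨l, hl, hlB⟩ := Finset.exists_mem_notMem_of_card_lt_card (s := B) (t := B') (by grind)
  exact MultilinearMap.map_coord_zero _ l (by simp [hl, hlB])

section GradedWeight

variable {n d : ℤ} {𝒱 : ℤ → Submodule k V} {𝒲 : ℤ → Submodule k k}
  {F : FormalMap k (V × Module.Dual k V) k}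

theorem ite_mem_cotangentGrading {u : V × Module.Dual k V} {i : ℤ}
    (hu : u ∈ cotangentGrading n 𝒱 i) (p : Prop) [Decidable p] :
    (if p then (0, u.2) else (u.1, 0)) ∈ cotangentGrading n 𝒱 i := by
  split_ifs
  · exact ⟨Submodule.zero_mem _, hu.2⟩
  · exact ⟨hu.1, Submodule.zero_mem _⟩

theorem IsGradedFormalMap.weightPart (hF : IsGradedFormalMap (cotangentGrading n 𝒱) 𝒲 d F)
    (j : ℕ) : IsGradedFormalMap (cotangentGrading n 𝒱) 𝒲 d (weightPart j F) where
  degree r a u hu := by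
    rw [weightPart_apply]
    exact Submodule.sum_mem _ fun B _ =>
      hF.degree r a _ fun i => ite_mem_cotangentGrading (hu i) _
  symm r a u hu i l hil := by
    rw [weightPart_apply, weightPart_apply, Finset.smul_sum]
    refine Finset.sum_equiv (Equiv.finsetCongr (Equiv.swap i l)) (fun B => ?_) fun B _ => ?_
    · simp [Finset.mem_powersetCard]
    · rw [← hF.symm r a _ (fun i => ite_mem_cotangentGrading (hu i) _) i l hil]
      refine congrArg (F r) (funext fun m => ?_)
      simp

theorem IsGradedFormalMap.weightGeTwo (hF : IsGradedFormalMap (cotangentGrading n 𝒱) 𝒲 d F) :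
    IsGradedFormalMap (cotangentGrading n 𝒱) 𝒲 d (weightGeTwo F) :=
  .sum hF.weightPart

end GradedWeight

/-! ### Fibrewise linear functions on the cotangent bundle -/

section LinearHamiltonian

theorem negOnePow_eq_of_modEq {m m' : ℤ} (h : m ≡ m' [ZMOD 2]) :
    m.negOnePow = m'.negOnePow :=
  (Int.negOnePow_eq_iff m m').2 (even_iff_two_dvd.2 h.symm.dvd)

variable (𝒱 : ℤ → Submodule k V) [DirectSum.Decomposition 𝒱]

theorem sum_smul_parityProj {r : ℕ} (c : (Fin r → Fin 2) → ℤˣ)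
    (G : MultilinearMap k (fun _ : Fin r => V) W) {a : Fin r → ℤ} {v : Fin r → V}
    (hv : ∀ j, v j ∈ 𝒱 (a j)) {e₀ : Fin r → Fin 2} (he₀ : ∀ j, ((e₀ j : ℕ) : ℤ) = a j % 2) :
    ∑ e : Fin r → Fin 2, c e • G (fun j => parityProj 𝒱 (e j) (v j)) = c e₀ • G v := by
  rw [Fintype.sum_eq_single e₀]
  · simp only [parityProj_of_mem _ (hv _), he₀, if_true]
  · intro e he
    obtain ⟨j, hj⟩ := Function.ne_iff.1 he
    rw [G.map_coord_zero j, smul_zero]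
    rw [parityProj_of_mem _ (hv j), if_neg]
    exact fun h => hj (Fin.ext (by exact_mod_cast (he₀ j ▸ h).symm))

theorem linearHamiltonian_apply (n : ℤ) (Q : FormalMap k V V) {r : ℕ}
    {a : Fin (r + 1) → ℤ} {u : Fin (r + 1) → V × Module.Dual k V} (hu : ∀ i, (u i).1 ∈ 𝒱 (a i)) :
    linearHamiltonian n 𝒱 Q (r + 1) u =
      ∑ i : Fin (r + 1), ((n + 1 + ∑ j, a (i.succAbove j)) *
        ∑ j with i ≤ Fin.castSucc j, a (i.succAbove j)).negOnePow •
          (u i).2 (Q r fun j => (u (i.succAbove j)).1) := by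
  have hparity (m : ℤ) : ∃ e : Fin 2, ((e : ℕ) : ℤ) = m % 2 :=
    ⟨⟨(m % 2).toNat, by lia⟩, by lia⟩
  choose e₀ he₀ using fun j => hparity (a j)
  simp only [linearHamiltonian, sum_apply]
  refine Finset.sum_congr rfl fun i _ => ?_
  refine (sum_smul_parityProj 𝒱 _ ((u i).2.compMultilinearMap (Q r)) (fun j => hu (i.succAbove j))
    fun j => he₀ (i.succAbove j)).trans (congrArg (· • _) (negOnePow_eq_of_modEq ?_))
  have hsum (s : Finset (Fin r)) :
      ∑ j ∈ s, ((e₀ (i.succAbove j) : ℕ) : ℤ) ≡ ∑ j ∈ s, a (i.succAbove j) [ZMOD 2] :=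
    Int.ModEq.sum fun j _ => he₀ (i.succAbove j) ▸ Int.mod_modEq _ _
  exact ((hsum _).add_left _).mul (hsum _)

end LinearHamiltonian

/-! ### The splitting of a Lagrangian with an isotropic complement -/

theorem mem_cotangentGrading_iff {n : ℤ} {𝒱 : ℤ → Submodule k V} {i : ℤ}
    {x : V × Module.Dual k V} :
    x ∈ cotangentGrading n 𝒱 i ↔ x.1 ∈ 𝒱 i ∧ ∀ j ≠ -n - i, ∀ a ∈ 𝒱 j, x.2 a = 0 := by
  simp [cotangentGrading, Submodule.mem_prod, Submodule.mem_iInf, Submodule.mem_dualAnnihilator]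

section Splitting

variable {T : Type*} [AddCommGroup T] [Module k T] {n : ℤ} {𝒯 : ℤ → Submodule k T}
  [DirectSum.Decomposition 𝒯] {𝒱 : ℤ → Submodule k V} [DirectSum.Decomposition 𝒱]
  {ω : LinearMap.BilinForm k T} {f : V →ₗ[k] T} {C : Submodule k T}

theorem IsIsotropicComplement.mem_of_apply_add_mem (hC : IsIsotropicComplement 𝒯 ω f C)
    (hf : IsDegreeZero 𝒱 𝒯 f) (hinj : Function.Injective f) {a : V} {w : T} (hw : w ∈ C) {i : ℤ}
    (h : f a + w ∈ 𝒯 i) : a ∈ 𝒱 i ∧ w ∈ 𝒯 i := by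
  obtain ⟨ha, hw⟩ := mem_and_mem_of_add_mem hf.isHomogeneous_range hC.homogeneous
    hC.isCompl.disjoint ⟨a, rfl⟩ hw h
  exact ⟨(hf.mem_iff hinj).1 ha, hw⟩

variable [FiniteDimensional k T]

section Linear

variable (hnd : ω.Nondegenerate) (hL : IsRegularEmbeddedLagrangian ω f)
  (hC : IsCompl (LinearMap.range f) C)

theorem splitting_inl (a : V) : splitting hnd hL hC (a, 0) = f a := by
  simp [splitting]

theorem splitting_inr_mem (ξ : Module.Dual k V) : splitting hnd hL hC (0, ξ) ∈ C := by
  simp [splitting]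

theorem splitting_apply (x : V × Module.Dual k V) :
    splitting hnd hL hC x = f x.1 + splitting hnd hL hC (0, x.2) := by
  rw [← splitting_inl hnd hL hC, ← map_add, Prod.mk_add_mk, add_zero, zero_add]

theorem apply_splitting_inr (a : V) (ξ : Module.Dual k V) :
    ω (f a) (splitting hnd hL hC (0, ξ)) = ξ a := by
  have hξ := LinearMap.congr_fun ((LinearEquiv.ofBijective (complementToDual ω f C)
    (complementToDual_bijective hnd hL hC)).apply_symm_apply ξ) a
  rw [splitting, LinearMap.coprod_apply, map_zero, zero_add]
  exact hξ

theorem splitting_bijective : Function.Bijective (splitting hnd hL hC) := by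
  let e := (LinearEquiv.ofBijective (complementToDual ω f C)
    (complementToDual_bijective hnd hL hC)).symm
  have hrange : LinearMap.range (C.subtype ∘ₗ e.toLinearMap) = C := by
    rw [LinearMap.range_comp_of_range_eq_top _ e.range, Submodule.range_subtype]
  constructor
  · rw [← LinearMap.ker_eq_bot, splitting,
      LinearMap.ker_coprod_of_disjoint_range _ _ (hrange.symm ▸ hC.disjoint),
      LinearMap.ker_eq_bot.2 hL.injective,
      (LinearMap.ker_eq_bot (f := C.subtype ∘ₗ e.toLinearMap)).2
        (C.subtype_injective.comp e.injective), Submodule.prod_bot]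
  · rw [← LinearMap.range_eq_top, splitting, LinearMap.range_coprod, hrange, hC.sup_eq_top]

end Linear

theorem IsShiftedPairing.apply_splitting_splitting (hω : IsShiftedPairing n 𝒯 ω)
    (hnd : ω.Nondegenerate) (hf : IsDegreeZero 𝒱 𝒯 f) (hL : IsRegularEmbeddedLagrangian ω f)
    (hC : IsIsotropicComplement 𝒯 ω f C) (x y : V × Module.Dual k V) :
    ω (splitting hnd hL hC.isCompl x) (splitting hnd hL hC.isCompl y) =
      cotangentForm n 𝒱 x y := by
  have hflip (ξ : Module.Dual k V) (b : V) :
      ω (splitting hnd hL hC.isCompl (0, ξ)) (f b) = -ξ (signTwist 𝒱 (n + 1) b) := by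
    rw [hω.apply_eq_neg_apply_signTwist, ← hf.map_signTwist, apply_splitting_inr]
  rw [splitting_apply _ _ _ x, splitting_apply _ _ _ y, map_add, map_add, LinearMap.add_apply,
    LinearMap.add_apply, hL.isotropic, apply_splitting_inr, hflip,
    hC.isotropic _ (splitting_inr_mem _ _ _ _) _ (splitting_inr_mem _ _ _ _), cotangentForm,
    LinearMap.mk₂_apply]
  ring

theorem IsShiftedPairing.isDegreeZero_splitting (hω : IsShiftedPairing n 𝒯 ω)
    (hnd : ω.Nondegenerate) (hf : IsDegreeZero 𝒱 𝒯 f) (hL : IsRegularEmbeddedLagrangian ω f)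
    (hC : IsIsotropicComplement 𝒯 ω f C) :
    IsDegreeZero (cotangentGrading n 𝒱) 𝒯 (splitting hnd hL hC.isCompl) := by
  intro i x hx
  obtain ⟨hx₁, hx₂⟩ := mem_cotangentGrading_iff.1 hx
  rw [splitting_apply]
  refine Submodule.add_mem _ (hf i _ hx₁) (hω.mem_of_forall_apply_eq_zero hnd fun j hj y hy => ?_)
  obtain ⟨_, ⟨a, rfl⟩, w, hw, rfl⟩ := Submodule.mem_sup.1
    (hC.isCompl.sup_eq_top ▸ Submodule.mem_top : y ∈ LinearMap.range f ⊔ C)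
  obtain ⟨ha, -⟩ := hC.mem_of_apply_add_mem hf hL.injective hw hy
  rw [hω.apply_eq_neg_apply_signTwist, signTwist_of_mem 𝒯 _ hy, LinearMap.map_smul_of_tower,
    LinearMap.smul_apply, map_add, LinearMap.add_apply, apply_splitting_inr, hx₂ j hj a ha,
    hC.isotropic _ hw _ (splitting_inr_mem _ _ _ _), add_zero, smul_zero, neg_zero]

theorem IsShiftedPairing.splitting_mem_iff (hω : IsShiftedPairing n 𝒯 ω)
    (hnd : ω.Nondegenerate) (hf : IsDegreeZero 𝒱 𝒯 f) (hL : IsRegularEmbeddedLagrangian ω f)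
    (hC : IsIsotropicComplement 𝒯 ω f C) {i : ℤ} {x : V × Module.Dual k V} :
    splitting hnd hL hC.isCompl x ∈ 𝒯 i ↔ x ∈ cotangentGrading n 𝒱 i := by
  refine ⟨fun hx => mem_cotangentGrading_iff.2 ?_, hω.isDegreeZero_splitting hnd hf hL hC i x⟩
  rw [splitting_apply] at hx
  obtain ⟨hx₁, hx₂⟩ := hC.mem_of_apply_add_mem hf hL.injective (splitting_inr_mem _ _ _ _) hx
  refine ⟨hx₁, fun j hj a ha => ?_⟩
  rw [← apply_splitting_inr hnd hL hC.isCompl]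
  exact hω.degree j i _ (hf j a ha) _ hx₂ (by lia)

theorem IsShiftedPairing.isInternal_cotangentGrading (hω : IsShiftedPairing n 𝒯 ω)
    (hnd : ω.Nondegenerate) (hf : IsDegreeZero 𝒱 𝒯 f) (hL : IsRegularEmbeddedLagrangian ω f)
    (hC : IsIsotropicComplement 𝒯 ω f C) : DirectSum.IsInternal (cotangentGrading n 𝒱) :=
  isInternal_of_linearEquiv (LinearEquiv.ofBijective _ (splitting_bijective hnd hL hC.isCompl))
    (fun _ _ => (hω.splitting_mem_iff hnd hf hL hC).symm) (DirectSum.Decomposition.isInternal 𝒯)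

end Splitting

/-! ### The induced twisted cotangent bundle -/

section InducedPoisson

variable {T : Type*} [AddCommGroup T] [Module k T] [FiniteDimensional k T] {n : ℤ}
  {𝒯 : ℤ → Submodule k T} {𝒱 : ℤ → Submodule k V} {Q : FormalMap k T T} {R : FormalMap k V V}
  {ω : LinearMap.BilinForm k T} {f : V →ₗ[k] T} {C : Submodule k T}

theorem weightPart_zero_pullback_splitting (hnd : ω.Nondegenerate) (hf : IsStrictMap 𝒱 R 𝒯 Q f)
    (hL : IsRegularEmbeddedLagrangian ω f) (hC : IsCompl (LinearMap.range f) C) :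
    weightPart 0 (pullback (splitting hnd hL hC) (actionFunctional ω Q)) = 0 := by
  funext r
  ext u
  rw [weightPart_zero_apply, pullback_apply]
  obtain _ | r := r
  · rfl
  have hu : (splitting hnd hL hC ∘ fun i => ((u i).1, 0)) =
      Fin.snoc (α := fun _ => T) (fun i => f (u i.castSucc).1) (f (u (Fin.last r)).1) := by
    funext i
    induction i using Fin.lastCases <;> simp [splitting_inl]
  rw [hu, actionFunctional_snoc, ← hf.comm, hL.isotropic]
  rfl

theorem actionFunctional_insertNth_splitting_inr (hQ : IsGradedFormalMap 𝒯 𝒯 1 Q)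
    (hω : IsShiftedSymplectic n 𝒯 Q ω) (hf : IsStrictMap 𝒱 R 𝒯 Q f)
    (hL : IsRegularEmbeddedLagrangian ω f) (hC : IsCompl (LinearMap.range f) C) {r : ℕ}
    {a : Fin r → ℤ} {v : Fin r → V} (hv : ∀ j, v j ∈ 𝒱 (a j)) {b : ℤ} {ξ : Module.Dual k V}
    (hξ : splitting hω.nondegenerate hL hC (0, ξ) ∈ 𝒯 b) (i : Fin (r + 1)) :
    actionFunctional ω Q (r + 1) (i.insertNth (α := fun _ => T)
        (splitting hω.nondegenerate hL hC (0, ξ)) fun j => f (v j)) =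
      ((n + 1 + ∑ j, a j) * ∑ j with i ≤ Fin.castSucc j, a j).negOnePow • ξ (R r v) := by
  have hfv (j) : f (v j) ∈ 𝒯 (a j) := hf.degree _ _ (hv j)
  have hξR : ξ (R r v) = ω (Q r fun j => f (v j)) (splitting hω.nondegenerate hL hC (0, ξ)) := by
    rw [← hf.comm, apply_splitting_inr]
  rw [(isGradedFormalMap_actionFunctional hQ hω).apply_insertNth hfv hξ, actionFunctional_snoc,
    hξR]
  by_cases hdeg : ∑ j, a j + 1 + b = -n
  · obtain rfl : b = -(n + 1 + ∑ j, a j) := by lia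
    rw [neg_mul, Int.negOnePow_neg]
  · rw [hω.degree _ _ _ (hQ.degree r a _ hfv) _ hξ hdeg, smul_zero, smul_zero]

variable [DirectSum.Decomposition 𝒯] [DirectSum.Decomposition 𝒱]

theorem weightPart_one_pullback_splitting (hQ : IsGradedFormalMap 𝒯 𝒯 1 Q)
    (hω : IsShiftedSymplectic n 𝒯 Q ω) (hf : IsStrictMap 𝒱 R 𝒯 Q f)
    (hL : IsRegularEmbeddedLagrangian ω f) (hC : IsIsotropicComplement 𝒯 ω f C) :
    weightPart 1 (pullback (splitting hω.nondegenerate hL hC.isCompl) (actionFunctional ω Q)) =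
      linearHamiltonian n 𝒱 R := by
  have hΦ := hω.isShiftedPairing.isDegreeZero_splitting hω.nondegenerate hf.degree hL hC
  let := (hω.isShiftedPairing.isInternal_cotangentGrading hω.nondegenerate hf.degree hL
    hC).chooseDecomposition
  funext r
  obtain _ | r := r
  · rfl
  refine multilinearMap_ext_homogeneous (cotangentGrading n 𝒱) fun a u hu => ?_
  have hu₁ (i) : (u i).1 ∈ 𝒱 (a i) := (hu i).1
  rw [linearHamiltonian_apply 𝒱 n R hu₁, weightPart_one_apply]
  refine Finset.sum_congr rfl fun i _ => ?_
  rw [pullback_apply, ← actionFunctional_insertNth_splitting_inr hQ hω hf hL hC.isCompl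
    (fun j => hu₁ (i.succAbove j)) (hΦ _ _ ⟨Submodule.zero_mem _, (hu i).2⟩)]
  refine congrArg (actionFunctional ω Q (r + 1)) (funext fun l => ?_)
  induction l using i.succAboveCases <;> simp [splitting_inl]

theorem linearHamiltonian_add_inducedPoisson (hQ : IsGradedFormalMap 𝒯 𝒯 1 Q)
    (hω : IsShiftedSymplectic n 𝒯 Q ω) (hf : IsStrictMap 𝒱 R 𝒯 Q f)
    (hL : IsRegularEmbeddedLagrangian ω f) (hC : IsIsotropicComplement 𝒯 ω f C) :
    linearHamiltonian n 𝒱 R + inducedPoisson Q hω.nondegenerate hL hC.isCompl =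
      pullback (splitting hω.nondegenerate hL hC.isCompl) (actionFunctional ω Q) := by
  conv_rhs => rw [← weightPart_add_weightGeTwo (pullback _ _),
    weightPart_zero_pullback_splitting hω.nondegenerate hf hL hC.isCompl, zero_add,
    weightPart_one_pullback_splitting hQ hω hf hL hC]
  rfl

variable [FiniteDimensional k V]

theorem isStrictMap_splitting (hQ : IsGradedFormalMap 𝒯 𝒯 1 Q)
    (hω : IsShiftedSymplectic n 𝒯 Q ω) (hf : IsStrictMap 𝒱 R 𝒯 Q f)
    (hL : IsRegularEmbeddedLagrangian ω f) (hC : IsIsotropicComplement 𝒯 ω f C) :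
    IsStrictMap (cotangentGrading n 𝒱) (inducedTwistedVF n 𝒱 R Q hω.nondegenerate hL hC.isCompl)
      𝒯 Q (splitting hω.nondegenerate hL hC.isCompl) where
  degree := hω.isShiftedPairing.isDegreeZero_splitting hω.nondegenerate hf.degree hL hC
  comm r v := by
    rw [inducedTwistedVF, twistedCotangentVF, cotangentVF, ← hamiltonianVF_add,
      linearHamiltonian_add_inducedPoisson hQ hω hf hL hC,
      map_hamiltonianVF_pullback hω.nondegenerate _
        (hω.isShiftedPairing.apply_splitting_splitting hω.nondegenerate hf.degree hL hC)
        (splitting_bijective hω.nondegenerate hL hC.isCompl).surjective,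
      hamiltonianVF_actionFunctional]

theorem isHomotopyPoisson_inducedPoisson (hQ : IsFormalModuliProblem 𝒯 Q)
    (hω : IsShiftedSymplectic n 𝒯 Q ω) (hf : IsStrictMap 𝒱 R 𝒯 Q f)
    (hL : IsRegularEmbeddedLagrangian ω f) (hC : IsIsotropicComplement 𝒯 ω f C) :
    IsHomotopyPoisson n 𝒱 R (inducedPoisson Q hω.nondegenerate hL hC.isCompl) where
  graded := ((isGradedFormalMap_actionFunctional hQ.graded hω).pullback
    (hω.isShiftedPairing.isDegreeZero_splitting hω.nondegenerate hf.degree hL hC)).weightGeTwo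
  weight_zero := weightPart_weightGeTwo (by decide) _
  weight_one := weightPart_weightGeTwo (by decide) _
  master r a u hu := by
    have hΦ := hω.isShiftedPairing.isDegreeZero_splitting hω.nondegenerate hf.degree hL hC
    rw [linearHamiltonian_add_inducedPoisson hQ.graded hω hf hL hC,
      poissonBracket_pullback hω.nondegenerate _
        (hω.isShiftedPairing.apply_splitting_splitting hω.nondegenerate hf.degree hL hC)
        (splitting_bijective hω.nondegenerate hL hC.isCompl).surjective]
    exact poissonBracket_actionFunctional hω.nondegenerate hQ hω fun i => hΦ _ _ (hu i)

theorem isStrictMap_zeroSection (hQ : IsGradedFormalMap 𝒯 𝒯 1 Q)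
    (hω : IsShiftedSymplectic n 𝒯 Q ω) (hf : IsStrictMap 𝒱 R 𝒯 Q f)
    (hL : IsRegularEmbeddedLagrangian ω f) (hC : IsIsotropicComplement 𝒯 ω f C) :
    IsStrictMap 𝒱 R (cotangentGrading n 𝒱)
      (inducedTwistedVF n 𝒱 R Q hω.nondegenerate hL hC.isCompl) (zeroSection k V) where
  degree _ _ ha := ⟨ha, Submodule.zero_mem _⟩
  comm r v := (splitting_bijective hω.nondegenerate hL hC.isCompl).injective <| by
    rw [(isStrictMap_splitting hQ hω hf hL hC).comm]
    simp only [zeroSection, LinearMap.inl_apply, splitting_inl, hf.comm]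

end InducedPoisson

end ShiftedPoisson

end

theorem mainTheorem6_general {k : Type*} [Field k] [NeZero (2 : k)] (n : ℤ)
    {T : Type*} [AddCommGroup T] [Module k T] [FiniteDimensional k T]
    (𝒯 : ℤ → Submodule k T) [DirectSum.Decomposition 𝒯]
    (Q : FormalMap k T T) (hQ : IsFormalModuliProblem 𝒯 Q)
    (ω : LinearMap.BilinForm k T) (hω : IsShiftedSymplectic n 𝒯 Q ω)
    {V : Type*} [AddCommGroup V] [Module k V] [FiniteDimensional k V]
    (𝒱 : ℤ → Submodule k V) [DirectSum.Decomposition 𝒱] (R : FormalMap k V V)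
    (f : V →ₗ[k] T) (hf : IsStrictMap 𝒱 R 𝒯 Q f) (hL : IsRegularEmbeddedLagrangian ω f) :
    (∃ C : Submodule k T, IsIsotropicComplement 𝒯 ω f C) ∧
    ∀ (C : Submodule k T) (hC : IsIsotropicComplement 𝒯 ω f C),
      IsHomotopyPoisson n 𝒱 R (inducedPoisson Q hω.nondegenerate hL hC.isCompl) ∧
      IsFormalModuliProblem (cotangentGrading n 𝒱)
        (inducedTwistedVF n 𝒱 R Q hω.nondegenerate hL hC.isCompl) ∧
      IsShiftedSymplectic n (cotangentGrading n 𝒱)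
        (inducedTwistedVF n 𝒱 R Q hω.nondegenerate hL hC.isCompl)
        (cotangentForm n 𝒱) ∧
      IsStrictMap 𝒱 R (cotangentGrading n 𝒱)
        (inducedTwistedVF n 𝒱 R Q hω.nondegenerate hL hC.isCompl)
        (zeroSection k V) ∧
      ∃ f' : V × Module.Dual k V →ₗ[k] T,
        IsStrictMap (cotangentGrading n 𝒱)
          (inducedTwistedVF n 𝒱 R Q hω.nondegenerate hL hC.isCompl) 𝒯 Q f' ∧
        (∀ x y, ω (f' x) (f' y) = cotangentForm n 𝒱 x y) ∧
        f' ∘ₗ zeroSection k V = f := by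
  have hpair := hω.isShiftedPairing
  have hnd := hω.nondegenerate
  refine ⟨exists_isIsotropicComplement hpair hnd hf.degree hL, fun C hC => ?_⟩
  have hΦ := isStrictMap_splitting hQ.graded hω hf hL hC
  have hinj := (splitting_bijective hnd hL hC.isCompl).injective
  have hsymp := hpair.apply_splitting_splitting hnd hf.degree hL hC
  have hmem (i x) := (hpair.splitting_mem_iff hnd hf.degree hL hC (i := i) (x := x)).1
  have hinternal := hpair.isInternal_cotangentGrading hnd hf.degree hL hC
  exact ⟨isHomotopyPoisson_inducedPoisson hQ hω hf hL hC,
    hΦ.isFormalModuliProblem hinj hmem hinternal hQ,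
    hΦ.isShiftedSymplectic hsymp (cotangentForm_nondegenerate n 𝒱) hω,
    isStrictMap_zeroSection hQ.graded hω hf hL hC, splitting hnd hL hC.isCompl, hΦ, hsymp,
    LinearMap.ext (splitting_inl hnd hL hC.isCompl)⟩

theorem mainTheorem6 {k : Type*} [Field k] [CharZero k] (n : ℤ)
    {T : Type*} [AddCommGroup T] [Module k T] [FiniteDimensional k T]
    (𝒯 : ℤ → Submodule k T) [DirectSum.Decomposition 𝒯]
    (Q : FormalMap k T T) (hQ : IsFormalModuliProblem 𝒯 Q)
    (ω : LinearMap.BilinForm k T) (hω : IsShiftedSymplectic n 𝒯 Q ω)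
    {V : Type*} [AddCommGroup V] [Module k V] [FiniteDimensional k V]
    (𝒱 : ℤ → Submodule k V) [DirectSum.Decomposition 𝒱]
    (R : FormalMap k V V) (hR : IsFormalModuliProblem 𝒱 R)
    (f : V →ₗ[k] T) (hf : IsStrictMap 𝒱 R 𝒯 Q f) (hL : IsRegularEmbeddedLagrangian ω f) :
    (∃ C : Submodule k T, IsIsotropicComplement 𝒯 ω f C) ∧
    ∀ (C : Submodule k T) (hC : IsIsotropicComplement 𝒯 ω f C),
      IsHomotopyPoisson n 𝒱 R (inducedPoisson Q hω.nondegenerate hL hC.isCompl) ∧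
      IsFormalModuliProblem (cotangentGrading n 𝒱)
        (inducedTwistedVF n 𝒱 R Q hω.nondegenerate hL hC.isCompl) ∧
      IsShiftedSymplectic n (cotangentGrading n 𝒱)
        (inducedTwistedVF n 𝒱 R Q hω.nondegenerate hL hC.isCompl)
        (cotangentForm n 𝒱) ∧
      IsStrictMap 𝒱 R (cotangentGrading n 𝒱)
        (inducedTwistedVF n 𝒱 R Q hω.nondegenerate hL hC.isCompl)
        (zeroSection k V) ∧
      ∃ f' : V × Module.Dual k V →ₗ[k] T,
        IsStrictMap (cotangentGrading n 𝒱)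
          (inducedTwistedVF n 𝒱 R Q hω.nondegenerate hL hC.isCompl) 𝒯 Q f' ∧
        (∀ x y, ω (f' x) (f' y) = cotangentForm n 𝒱 x y) ∧
        f' ∘ₗ zeroSection k V = f :=
  mainTheorem6_general n 𝒯 Q hQ ω hω 𝒱 R f hf hL
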